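/- **Random tensor networks.** Let $G$ be a finite connected graph with vertex set $V$. Its edges are called internal, and each vertex $v$ in addition carries $e_v\ge 0$ external edges (physical sites) and one logical leg. Let $n=\sum_v e_v$, and let physical, internal and logical legs have dimensions $a,b,d$. Independently at each vertex, put a tensor $U_v|0\rangle\in(\mathbb C^a)^{\otimes e_v}\otimes\mathbb C^d\otimes\bigotimes_{w\sim v}\mathbb C^b$, where $U_v$ is a Haar-random unitary and $|0\rangle$ an arbitrary fixed unit vector. Contracting all internal edges with EPR pairs and projecting the logical legs on a unit vector $|\Phi\rangle\in(\mathbb C^d)^{\otimes V}$ gives the boundary state vector $|\psi\rangle\in(\mathbb C^a)^{\otimes n}$ of the random tensor network (RTN). For a reference unit vector $|\phi\rangle\in(\mathbb C^a)^{\otimes n}$, its inverse effective dimension is $$\frac1{D_{\rm eff}}=a^n\,\frac{\mathbb E\big[|\langle\psi|\phi\rangle|^4\big]}{\big(\mathbb E[\langle\psi|\psi\rangle]\big)^2}.$$ A random tensor train (RTT) with $n$ sites is the RTN on an open or closed chain of $n$ vertices with one physical site each. **Tilings.** For integers $p,q\ge3$ with $\frac1p+\frac1q<\frac12$, consider the regular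 hyperbolic tiling $\{p,q\}$ by $p$-gons (tiles), $q$ of which meet at each corner. Let $P_0$ be a single tile and let $P_{L+1}$ consist of $P_L$ and all tiles that share a corner with a tile of $P_L$ (vertex inflation). The RTN on the patch $P_L$ has one tensor per tile, an internal edge for each side shared by two tiles of $P_L$, and an external edge for each side of a tile of $P_L$ on the boundary of $P_L$; let $n_L$ be the number of these boundary sites. **Lemma (hyperbolic vs. RTT equilibration).** Let $p>3$, $q\ge 3$ with $\frac1p+\frac1q<\frac12$ and let $b\ge2$. There is $N$, depending only on $p,q,b$, such that the following holds for all $L$ with $n:=n_L\ge N$, all physical dimensions $a\ge2$ and all logical dimensions $d,d'\ge1$. The RTN on $P_L$ with dimensions $a,b,d$ and every RTT, with open or closed boundary conditions, with the same number $n$ of sites, the same dimensions $a,b$, and logical dimension $d'$, satisfy $$\frac1{D_{\rm eff}^{\{p,q\}}}<\frac1{D_{\rm eff}^{\rm RTT}},$$ provided that in both networks the bulk state vector $|\Phi\rangle$ and the boundary reference state vector $|\phi\rangle$ are unentangled, i.e. tensor products of one-site unit vectors. -/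

import Mathlib

open MeasureTheory

/-! ### Haar measure on the unitary group -/

section Haar

variable {ι : Type*} [Fintype ι] [DecidableEq ι]

instance unitaryGroupCompactSpace : CompactSpace (Matrix.unitaryGroup ι ℂ) := by
  have hclosed : IsClosed (Matrix.unitaryGroup ι ℂ : Set (Matrix ι ι ℂ)) := by
    have h : (Matrix.unitaryGroup ι ℂ : Set (Matrix ι ι ℂ)) = {A | A * star A = 1} := by
      ext A
      exact Matrix.mem_unitaryGroup_iff
    rw [h]
    exact isClosed_eq (by fun_prop) continuous_const
  have hbdd : IsCompact
      (Set.pi Set.univ fun _ : ι => Set.pi Set.univ fun _ : ι => Metric.closedBall (0 : ℂ) 1) :=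
    isCompact_univ_pi fun _ => isCompact_univ_pi fun _ => isCompact_closedBall _ _
  have hsub : (Matrix.unitaryGroup ι ℂ : Set (Matrix ι ι ℂ)) ⊆
      (Set.pi Set.univ fun _ : ι => Set.pi Set.univ fun _ : ι => Metric.closedBall (0 : ℂ) 1) := by
    intro A hA i _ j _
    simpa using entry_norm_bound_of_unitary hA i j
  exact isCompact_iff_compactSpace.mp (hbdd.of_isClosed_subset hclosed hsub)

noncomputable instance unitaryGroupMeasurableSpace : MeasurableSpace (Matrix.unitaryGroup ι ℂ) := borel _

instance unitaryGroupBorelSpace : BorelSpace (Matrix.unitaryGroup ι ℂ) := ⟨rfl⟩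

end Haar

/-- The Haar probability measure on the unitary group `U(ι)`. -/
noncomputable def haarUnitary (ι : Type*) [Fintype ι] [DecidableEq ι] :
    Measure (Matrix.unitaryGroup ι ℂ) :=
  Measure.haarMeasure ⊤

/-! ### State vectors -/

/-- A vector of `ℂ^I`, given by its coordinates, is normalized. -/
def IsNormalized {I : Type*} [Fintype I] (f : I → ℂ) : Prop :=
  ∑ i, ‖f i‖ ^ 2 = 1

/-- A state vector of `⨂_{s ∈ S} ℂ^k`, given by its coordinates in the product basis, is
unentangled: it is a tensor product of normalized one-site state vectors. -/
def IsUnentangled {S : Type*} [Fintype S] {k : ℕ} (ψ : (S → Fin k) → ℂ) : Prop :=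
  ∃ f : S → Fin k → ℂ, (∀ s, IsNormalized (f s)) ∧ ∀ x, ψ x = ∏ s, f s (x s)

/-! ### Random tensor networks

A network is given by a graph `G` on a finite vertex set `V`, whose edges are the internal
(contracted) edges, and the number `ext v` of external (physical) edges at each vertex `v`.
Every vertex moreover carries one logical (bulk) leg. The dimensions of physical, internal and
logical legs are `a`, `b` and `d`. -/

/-- The physical sites: the external edges of the network. -/
abbrev PhysSite {V : Type*} (ext : V → ℕ) : Type _ := Σ v : V, Fin (ext v)

/-- Product basis of the space `(ℂ^a)^{⊗ ext v} ⊗ ℂ^d ⊗ ⨂_{w adjacent to v} ℂ^b` of the tensor at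
the vertex `v`. -/
abbrev TensorIndex {V : Type*} (G : SimpleGraph V) (ext : V → ℕ) (a b d : ℕ) (v : V) : Type _ :=
  (Fin (ext v) → Fin a) × Fin d × (G.neighborSet v → Fin b)

open Classical in
/-- The data that enter a random tensor network state and its effective dimension: the normalized
vectors `ref v` (called `|0⟩`) on which the random unitaries act, the logical bulk state vector `Φ`
and the boundary reference state vector `φ`. -/
structure RTN {V : Type*} [Fintype V] (G : SimpleGraph V) (ext : V → ℕ) (a b d : ℕ) where
  ref : ∀ v, TensorIndex G ext a b d v → ℂ
  ref_normalized : ∀ v, IsNormalized (ref v)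
  bulk : (V → Fin d) → ℂ
  bulk_normalized : IsNormalized bulk
  bdy : (PhysSite ext → Fin a) → ℂ
  bdy_normalized : IsNormalized bdy

namespace RTN

variable {V : Type*} [Fintype V] {G : SimpleGraph V} {ext : V → ℕ} {a b d : ℕ}

/-- Both the bulk and the boundary reference state vector are unentangled. -/
def Unentangled (R : RTN G ext a b d) : Prop :=
  IsUnentangled R.bulk ∧ IsUnentangled R.bdy

open Classical in
/-- A sample of the ensemble: one unitary for every vertex. -/
abbrev Sample (_R : RTN G ext a b d) : Type _ :=
  ∀ v, Matrix.unitaryGroup (TensorIndex G ext a b d v) ℂ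

open Classical in
/-- The law of the sample: independent Haar-random unitaries. -/
noncomputable def law (R : RTN G ext a b d) : Measure R.Sample :=
  Measure.pi fun v => haarUnitary (TensorIndex G ext a b d v)

open Classical in
/-- The tensor `U_v |0⟩` at the vertex `v`. -/
noncomputable def tensor (R : RTN G ext a b d) (U : R.Sample) (v : V) :
    TensorIndex G ext a b d v → ℂ :=
  (U v : Matrix (TensorIndex G ext a b d v) (TensorIndex G ext a b d v) ℂ).mulVec (R.ref v)

open Classical in
/-- The (in general not normalized) state vector
`ψ = ⟨Φ| ⨂_{⟨j,k⟩} ⟨j k| ⨂_v U_v |0⟩` on the physical sites, in coordinates. Here `e` runs over the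
basis states of the internal edges and `β` over those of the logical legs; the EPR pair on an edge
is taken as `∑ i, |i⟩|i⟩`, as its normalization cancels in `invEffDim`. -/
noncomputable def state (R : RTN G ext a b d) (U : R.Sample) : (PhysSite ext → Fin a) → ℂ :=
  fun x => ∑ e : G.edgeSet → Fin b, ∑ β : V → Fin d,
    star (R.bulk β) *
      ∏ v, R.tensor U v (fun j => x ⟨v, j⟩, β v, fun w => e ⟨s(v, w.1), w.2⟩)

open Classical in
/-- The overlap `⟨ψ|φ⟩`. -/
noncomputable def overlap (R : RTN G ext a b d) (U : R.Sample) : ℂ :=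
  ∑ x, star (R.state U x) * R.bdy x

open Classical in
/-- The squared norm `⟨ψ|ψ⟩`. -/
noncomputable def normSq (R : RTN G ext a b d) (U : R.Sample) : ℝ :=
  ∑ x, ‖R.state U x‖ ^ 2

open Classical in
/-- The inverse effective dimension `1 / D_eff = a^n E[|⟨ψ|φ⟩|^4] / (E[⟨ψ|ψ⟩])^2`, where `n` is the
number of physical sites. -/
noncomputable def invEffDim (R : RTN G ext a b d) : ℝ :=
  (a : ℝ) ^ Fintype.card (PhysSite ext) *
    ((∫ U, ‖R.overlap U‖ ^ 4 ∂(R.law)) / (∫ U, R.normSq U ∂(R.law)) ^ 2)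

end RTN

/-! ### Layered patches of the regular tiling `{p,q}`

The patch with `L` layers is grown from a single `p`-gon (layer `0`) by vertex inflation: layer
`ℓ + 1` consists of the tiles that have to be added so that every corner on the boundary of the
patch built so far is surrounded by exactly `q` tiles.

The tiles of a layer are listed in cyclic order. A tile is recorded by the list of the positions, in
the previous layer, of the tiles with which it shares a side (no, one or two of them: types
`γ`, `β`, `α`). For layers `ℓ ≥ 1` a tile also shares one side with each of its two cyclic
neighbours in the layer; its other sides lie on the boundary.

The boundary of the patch is recorded as the cyclic list of its sides `(i, t)`, where `i` is the
position in the last layer of the tile to which the side belongs and `t` is the number of tiles of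
the patch that meet at the corner at the end of the side. -/

/-- The tiles of the next layer, in cyclic order. A new tile is glued to the boundary side `(i, t)`.
At the corner after it `q - t` new tiles are needed; two of them are the tiles glued to the two sides
that meet there, so `q - t - 2` tiles touching the patch only in this corner come in between. If only
one new tile fits in (`q - t = 1`), it is glued to both sides. -/
def inflate (q : ℕ) : List (ℕ × ℕ) → List (List ℕ)
  | [] => []
  | (i, t) :: bs =>
    if t + 2 ≤ q then [i] :: (List.replicate (q - t - 2) [] ++ inflate q bs)
    else
      match inflate q bs with
      | [] => [[i]]
      | u :: us => (i :: u) :: us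

/-- The boundary of the patch whose last layer, of index `ℓ`, is `ts`. The `p` sides of the first
tile are all on the boundary. In a layer `ℓ ≥ 1`, a tile `j` with `k` inner neighbours has `p - 2 - k`
sides on the boundary; both tiles `j - 1` and `j` meet at the end of the last of those of `j - 1`, and
only one tile at the ends of the others. The cyclic list is cut before the last side of the last
tile. -/
def patchBoundary (p : ℕ) : ℕ → List (List ℕ) → List (ℕ × ℕ)
  | 0, _ => List.replicate p (0, 1)
  | _ + 1, ts =>
    (List.finRange ts.length).flatMap fun j =>
      ((j.val + ts.length - 1) % ts.length, 2) ::
        List.replicate (p - 3 - (ts.get j).length) (j.val, 1)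

/-- The layers of the tiling. -/
def tilingLayer (p q : ℕ) : ℕ → List (List ℕ)
  | 0 => [[]]
  | ℓ + 1 => inflate q (patchBoundary p ℓ (tilingLayer p q ℓ))

/-- The tiles of the patch consisting of the layers `0, …, L`. The tensors are placed on them. -/
abbrev PatchTile (p q L : ℕ) : Type := Σ ℓ : Fin (L + 1), Fin (tilingLayer p q ℓ).length

/-- The graph of internal edges: two tiles of the patch are adjacent if they share a side, that is, if
they are cyclic neighbours in their layer, or one is glued to the other from the next layer. -/
def patchGraph (p q L : ℕ) : SimpleGraph (PatchTile p q L) :=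
  SimpleGraph.fromRel fun s t =>
    (s.1 = t.1 ∧ t.2.val = (s.2.val + 1) % (tilingLayer p q s.1).length) ∨
      (s.1.val + 1 = t.1.val ∧ s.2.val ∈ (tilingLayer p q t.1).get t.2)

/-- The external edges: each tile has one for each of its sides on the boundary of the patch. -/
def patchExt (p q L : ℕ) (s : PatchTile p q L) : ℕ :=
  if s.1.val = L then
    (patchBoundary p L (tilingLayer p q L)).countP fun side => side.1 = s.2.val
  else 0

/-- The number of physical sites of the patch. -/
def patchSites (p q L : ℕ) : ℕ := Fintype.card (PhysSite (patchExt p q L))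

/-! ### Random tensor trains

One physical leg per tensor, on an open chain or on a closed chain of `n` tensors. -/

/-- Random tensor train with `n` sites on an open chain. -/
abbrev OpenRTT (n a b d : ℕ) : Type :=
  RTN (SimpleGraph.pathGraph n) (fun _ => 1) a b d

/-- Random tensor train with `n` sites on a closed chain. -/
abbrev ClosedRTT (n a b d : ℕ) : Type :=
  RTN (SimpleGraph.cycleGraph n) (fun _ => 1) a b d

/-! ### Moments of a Haar-random vector -/

section HaarMoments

variable {ι : Type*} [Fintype ι] [DecidableEq ι]

/-! Haar averaging turns the inverse effective dimension into an Ising partition function. The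
fourth moment of a Haar vector in dimension D is the sum of two pairings of the copies, identity and
swap, divided by D(D+1), so each vertex carries a two-valued spin. For product vectors Φ and φ the
physical and logical legs contribute 1 for either spin, and an internal edge contributes b² if its
end spins agree and b otherwise. Dividing by the squared mean norm, `RTN.invEffDim_eq` gives 1/D_eff
= a^(-n) ∏ D_v/(D_v+1) · Z(x), with x = 1/b and Z(x) the sum over spin configurations of x to the
number of unequal edges.

The factor a^(-n) is common to both networks. On a chain Z is 2(1+x)^(n-1), up to a factor x at
worst for a closing edge, and D_v ≥ 2b² away from the ends. So the RTT value is at least a^(-n)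
times a constant times (ρ(1+x))^n, where ρ = 1/(1+x²/2), uniformly in a and d'
(`le_invEffDim_tensorTrain`). For the patch, drop the dimension factors, which are at most 1, and
delete edges, which increases Z; a spanning tree on T tiles gives Z ≤ 2(1+x)^(T-1). If the exponent
is at most (17/24)n, then (1+x²/2)^24 < (1+x)^7 (`one_add_pow_lt`) yields an exponential gap, which
beats all constants for large n (`exists_pow_bound`).

Tiles and boundary sites obey linear recursions over the layers, which lead to `innerTiles_eq`. The
tree reaches 17/24 for every tiling except {4,5}, where T/n tends to about 0.87. There the chosen
subgraph keeps one cycle for each side of each inner boundary, except one per layer. Each cycle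
saves a factor (1+x)^(1/2) (`IsingBound.segments`), and the exponent drops to about 0.683 n. -/

instance haarUnitary_isProbabilityMeasure : IsProbabilityMeasure (haarUnitary ι) :=
  ⟨by
    have h := Measure.haarMeasure_self (K₀ := (⊤ : TopologicalSpace.PositiveCompacts
      (Matrix.unitaryGroup ι ℂ)))
    simpa [haarUnitary] using h⟩

instance haarUnitary_isMulLeftInvariant : (haarUnitary ι).IsMulLeftInvariant := by
  unfold haarUnitary; infer_instance

/-- The random vector `U r`. -/
noncomputable def haarVec (r : ι → ℂ) (U : Matrix.unitaryGroup ι ℂ) : ι → ℂ :=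
  (U : Matrix ι ι ℂ).mulVec r

theorem continuous_haarVec (r : ι → ℂ) (i : ι) : Continuous fun U => haarVec r U i := by
  have h : ∀ j, Continuous fun U : Matrix.unitaryGroup ι ℂ => (U : Matrix ι ι ℂ) i j := fun j =>
    (continuous_apply j).comp ((continuous_apply i).comp continuous_subtype_val)
  exact continuous_finsetSum _ fun j _ => (h j).mul continuous_const

theorem Continuous.integrable_haarUnitary {f : Matrix.unitaryGroup ι ℂ → ℂ} (hf : Continuous f) :
    Integrable f (haarUnitary ι) :=
  hf.integrable_of_hasCompactSupport (HasCompactSupport.of_compactSpace f)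

theorem haarVec_mul (r : ι → ℂ) (W U : Matrix.unitaryGroup ι ℂ) :
    haarVec r (W * U) = (W : Matrix ι ι ℂ).mulVec (haarVec r U) := by
  simp [haarVec, Matrix.mulVec_mulVec]

theorem sum_normSq_haarVec (r : ι → ℂ) (hr : IsNormalized r) (U : Matrix.unitaryGroup ι ℂ) :
    ∑ i, haarVec r U i * star (haarVec r U i) = 1 := by
  have h : ∑ i, haarVec r U i * star (haarVec r U i) =
      dotProduct (star (haarVec r U)) (haarVec r U) := by
    simp [dotProduct, mul_comm]
  rw [h, haarVec, Matrix.star_mulVec, Matrix.dotProduct_mulVec, Matrix.vecMul_vecMul]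
  have hU : (U : Matrix ι ι ℂ).conjTranspose * (U : Matrix ι ι ℂ) = 1 :=
    Matrix.mem_unitaryGroup_iff'.mp U.2
  rw [hU, Matrix.vecMul_one]
  unfold IsNormalized at hr
  have : ((∑ i, ‖r i‖ ^ 2 : ℝ) : ℂ) = 1 := by rw [hr]; simp
  rw [← this]
  push_cast
  refine Finset.sum_congr rfl fun i _ => ?_
  simp [Complex.conj_mul']

/-- The second moments of `U r`. -/
noncomputable def moment₂ (r : ι → ℂ) (i j : ι) : ℂ :=
  ∫ U, haarVec r U i * star (haarVec r U j) ∂haarUnitary ι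

/-- The fourth moments of `U r`. -/
noncomputable def moment₄ (r : ι → ℂ) (i j k l : ι) : ℂ :=
  ∫ U, haarVec r U i * haarVec r U j * star (haarVec r U k) * star (haarVec r U l) ∂haarUnitary ι

theorem integral_bilinear_haarVec (r : ι → ℂ) (c e : ι → ℂ) :
    ∫ U, (∑ i, c i * haarVec r U i) * star (∑ i, e i * haarVec r U i) ∂haarUnitary ι =
      ∑ i, ∑ j, c i * star (e j) * moment₂ r i j := by
  have hc := continuous_haarVec r
  have h : ∀ U, (∑ i, c i * haarVec r U i) * star (∑ i, e i * haarVec r U i) =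
      ∑ i, ∑ j, c i * star (e j) * (haarVec r U i * star (haarVec r U j)) := by
    intro U
    rw [star_sum, Finset.sum_mul_sum]
    refine Finset.sum_congr rfl fun i _ => Finset.sum_congr rfl fun j _ => ?_
    rw [star_mul']; ring
  simp_rw [h]
  rw [integral_finsetSum _ fun i _ => Continuous.integrable_haarUnitary (by fun_prop)]
  refine Finset.sum_congr rfl fun i _ => ?_
  rw [integral_finsetSum _ fun i _ => Continuous.integrable_haarUnitary (by fun_prop)]
  refine Finset.sum_congr rfl fun j _ => ?_
  rw [integral_const_mul, moment₂]

theorem integral_quartic_haarVec (r : ι → ℂ) (c₁ c₂ c₃ c₄ : ι → ℂ) :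
    ∫ U, (∑ i, c₁ i * haarVec r U i) * (∑ i, c₂ i * haarVec r U i) *
        star (∑ i, c₃ i * haarVec r U i) * star (∑ i, c₄ i * haarVec r U i) ∂haarUnitary ι =
      ∑ i, ∑ j, ∑ k, ∑ l, c₁ i * c₂ j * star (c₃ k) * star (c₄ l) * moment₄ r i j k l := by
  have hc := continuous_haarVec r
  have h : ∀ U, (∑ i, c₁ i * haarVec r U i) * (∑ i, c₂ i * haarVec r U i) *
        star (∑ i, c₃ i * haarVec r U i) * star (∑ i, c₄ i * haarVec r U i) =
      ∑ i, ∑ j, ∑ k, ∑ l, c₁ i * c₂ j * star (c₃ k) * star (c₄ l) *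
        (haarVec r U i * haarVec r U j * star (haarVec r U k) * star (haarVec r U l)) := by
    intro U
    rw [star_sum, star_sum]
    simp only [Finset.sum_mul, Finset.mul_sum]
    rw [Finset.sum_congr rfl fun l _ => Finset.sum_congr rfl fun k _ => Finset.sum_comm]
    rw [Finset.sum_congr rfl fun l _ => Finset.sum_comm]
    rw [Finset.sum_comm]
    refine Finset.sum_congr rfl fun i _ => ?_
    rw [Finset.sum_congr rfl fun l _ => Finset.sum_comm]
    rw [Finset.sum_comm]
    refine Finset.sum_congr rfl fun j _ => ?_
    rw [Finset.sum_comm]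
    refine Finset.sum_congr rfl fun k _ => Finset.sum_congr rfl fun l _ => ?_
    rw [star_mul', star_mul']; ring
  simp_rw [h]
  rw [integral_finsetSum _ fun i _ => Continuous.integrable_haarUnitary (by fun_prop)]
  refine Finset.sum_congr rfl fun i _ => ?_
  rw [integral_finsetSum _ fun i _ => Continuous.integrable_haarUnitary (by fun_prop)]
  refine Finset.sum_congr rfl fun j _ => ?_
  rw [integral_finsetSum _ fun i _ => Continuous.integrable_haarUnitary (by fun_prop)]
  refine Finset.sum_congr rfl fun k _ => ?_
  rw [integral_finsetSum _ fun i _ => Continuous.integrable_haarUnitary (by fun_prop)]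
  refine Finset.sum_congr rfl fun l _ => ?_
  rw [integral_const_mul, moment₄]

/-- The unitary multiplying the coordinate `p` by the imaginary unit. -/
noncomputable def phaseUnitary (p : ι) : Matrix.unitaryGroup ι ℂ :=
  ⟨Matrix.diagonal fun i => if i = p then Complex.I else 1, by
    rw [Matrix.mem_unitaryGroup_iff, Matrix.star_eq_conjTranspose, Matrix.diagonal_conjTranspose,
      Matrix.diagonal_mul_diagonal, ← Matrix.diagonal_one]
    congr 1
    ext i
    by_cases h : i = p <;> simp [h]⟩

theorem haarVec_phaseUnitary_mul (r : ι → ℂ) (p : ι) (U : Matrix.unitaryGroup ι ℂ) (i : ι) :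
    haarVec r (phaseUnitary p * U) i = (if i = p then Complex.I else 1) * haarVec r U i := by
  rw [haarVec_mul]
  simp [phaseUnitary, Matrix.mulVec_diagonal]

/-- The reflection in the plane of the coordinates `p` and `q` with entries `±7/25`, `-24/25`. -/
noncomputable def reflectionUnitary (p q : ι) (h : p ≠ q) : Matrix.unitaryGroup ι ℂ :=
  ⟨1 - (2 : ℂ) • Matrix.vecMulVec (Pi.single p (3 / 5) + Pi.single q (4 / 5))
      (Pi.single p (3 / 5) + Pi.single q (4 / 5)), by
    set v : ι → ℂ := Pi.single p (3 / 5) + Pi.single q (4 / 5) with hv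
    have hstar : star v = v := by
      ext i
      simp only [hv, Pi.star_apply, Pi.add_apply, Pi.single_apply, star_add]
      split_ifs <;> simp
    have hvv : dotProduct v v = 1 := by
      simp [hv, h, h.symm]
      norm_num
    rw [Matrix.mem_unitaryGroup_iff, Matrix.star_eq_conjTranspose, Matrix.conjTranspose_sub,
      Matrix.conjTranspose_smul, Matrix.conjTranspose_vecMulVec, hstar, Matrix.conjTranspose_one]
    simp only [sub_mul, mul_sub, one_mul, mul_one, Matrix.smul_mul, Matrix.mul_smul,
      Matrix.vecMulVec_mul_vecMulVec, hvv]
    ext i j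
    simp
    ring⟩

theorem haarVec_reflectionUnitary_mul (r : ι → ℂ) (p q : ι) (h : p ≠ q)
    (U : Matrix.unitaryGroup ι ℂ) :
    haarVec r (reflectionUnitary p q h * U) p =
        ∑ i, (Pi.single p (7 / 25) + Pi.single q (-24 / 25) : ι → ℂ) i * haarVec r U i ∧
      haarVec r (reflectionUnitary p q h * U) q =
        ∑ i, (Pi.single p (-24 / 25) + Pi.single q (-7 / 25) : ι → ℂ) i * haarVec r U i := by
  rw [haarVec_mul]
  constructor <;>
  · simp [reflectionUnitary, Matrix.sub_mulVec, Matrix.smul_mulVec, Matrix.vecMulVec_mulVec,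
      add_mul, Finset.sum_add_distrib, Pi.single_apply, h, h.symm, add_dotProduct]
    ring


/-- Rotating coordinate i by the imaginary unit preserves Haar measure but multiplies this moment by
that unit. -/
theorem moment₂_eq_zero (r : ι → ℂ) {i j : ι} (h : i ≠ j) : moment₂ r i j = 0 := by
  have key : moment₂ r i j = Complex.I * moment₂ r i j := by
    conv_lhs => rw [moment₂, ← integral_mul_left_eq_self _ (phaseUnitary i)]
    rw [moment₂, ← integral_const_mul]
    refine integral_congr_ae (.of_forall fun U => ?_)
    simp only [haarVec_phaseUnitary_mul, if_neg h.symm, if_true, one_mul, mul_assoc]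
  have : (1 - Complex.I) * moment₂ r i j = 0 := by linear_combination key
  rcases mul_eq_zero.mp this with h | h
  · simp [Complex.ext_iff] at h
  · exact h

theorem moment₄_phase (r : ι → ℂ) (p i j k l : ι) :
    moment₄ r i j k l = (if i = p then Complex.I else 1) * (if j = p then Complex.I else 1) *
      (if k = p then -Complex.I else 1) * (if l = p then -Complex.I else 1) *
        moment₄ r i j k l := by
  conv_lhs => rw [moment₄, ← integral_mul_left_eq_self _ (phaseUnitary p)]
  rw [moment₄, ← integral_const_mul]
  refine integral_congr_ae (.of_forall fun U => ?_)
  simp only [haarVec_phaseUnitary_mul, star_mul', apply_ite star, Complex.star_def, Complex.conj_I,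
    map_one]
  ring

/-- A nonzero moment must be unchanged by a phase on any single coordinate, so every index occurs
equally often among the plain and the conjugated factors. Testing the phases at i and j suffices. -/
theorem moment₄_eq_zero (r : ι → ℂ) {i j k l : ι} (h : ¬((i = k ∧ j = l) ∨ (i = l ∧ j = k))) :
    moment₄ r i j k l = 0 := by
  by_contra hM
  have key : ∀ p, (if i = p then Complex.I else 1) * (if j = p then Complex.I else 1) *
      (if k = p then -Complex.I else 1) * (if l = p then -Complex.I else 1) = 1 := fun p =>
    mul_right_cancel₀ hM (by rw [one_mul]; exact (moment₄_phase r p i j k l).symm)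
  have hi := key i
  have hj := key j
  rcases eq_or_ne i j with rfl | h1
  · rcases eq_or_ne i k with rfl | h2 <;> rcases eq_or_ne i l with rfl | h3
    · simp at h
    · norm_num [Complex.ext_iff, h3.symm] at hi
    · norm_num [Complex.ext_iff, h2.symm] at hi
    · norm_num [Complex.ext_iff, h2.symm, h3.symm] at hi
  · rcases eq_or_ne i k with rfl | h2 <;> rcases eq_or_ne i l with rfl | h3
    · norm_num [Complex.ext_iff, h1.symm] at hi
    · rcases eq_or_ne l j with rfl | h4
      · simp at h
      · norm_num [Complex.ext_iff, h1, h4] at hj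
    · rcases eq_or_ne k j with rfl | h4
      · simp at h
      · norm_num [Complex.ext_iff, h1, h4] at hj
    · norm_num [Complex.ext_iff, h1.symm, h2.symm, h3.symm] at hi

theorem moment₂_reflection (r : ι → ℂ) {p q : ι} (h : p ≠ q) : moment₂ r p p = moment₂ r q q := by
  have key : moment₂ r p p = ∑ i, ∑ j, (Pi.single p (7 / 25) + Pi.single q (-24 / 25) : ι → ℂ) i *
      star ((Pi.single p (7 / 25) + Pi.single q (-24 / 25) : ι → ℂ) j) * moment₂ r i j := by
    rw [← integral_bilinear_haarVec, moment₂,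
      ← integral_mul_left_eq_self _ (reflectionUnitary p q h)]
    simp only [(haarVec_reflectionUnitary_mul r p q h _).1]
  have hz := moment₂_eq_zero r h
  have hz' := moment₂_eq_zero r h.symm
  simp only [Pi.add_apply, star_add, add_mul, mul_add, Finset.sum_add_distrib, Pi.single_apply,
    apply_ite star, star_zero, ite_mul, mul_ite, zero_mul, mul_zero, Finset.sum_ite_eq',
    Finset.mem_univ, if_true, hz, hz'] at key
  simp at key
  linear_combination (625 / 576) * key

theorem moment₂_eq (r : ι → ℂ) (hr : IsNormalized r) (i j : ι) :
    moment₂ r i j = if i = j then 1 / (Fintype.card ι : ℂ) else 0 := by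
  split_ifs with hij
  · subst hij
    have hsum : ∑ k, moment₂ r k k = 1 := by
      have hc := continuous_haarVec r
      simp only [moment₂]
      rw [← integral_finsetSum _ fun i _ => Continuous.integrable_haarUnitary (by fun_prop)]
      simp only [sum_normSq_haarVec r hr]
      simp
    have hall : ∀ k, moment₂ r k k = moment₂ r i i := fun k => by
      by_cases h : k = i
      · rw [h]
      · exact moment₂_reflection r h
    rw [Finset.sum_congr rfl fun k _ => hall k] at hsum
    rw [Finset.sum_const, Finset.card_univ, nsmul_eq_mul] at hsum
    exact eq_one_div_of_mul_eq_one_right hsum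
  · exact moment₂_eq_zero r hij

/-- If the fourth moments are supported on pairings, quartic sums collapse. -/
theorem sum_moment₄ (r : ι → ℂ) (c : ι → ℂ) :
    ∑ i, ∑ j, ∑ k, ∑ l, c i * c j * star (c k) * star (c l) * moment₄ r i j k l =
      ∑ i, ∑ j, (if i = j then 1 else 2) * ((c i * star (c i)) * (c j * star (c j))) *
        moment₄ r i j i j := by
  refine Finset.sum_congr rfl fun i _ => Finset.sum_congr rfl fun j _ => ?_
  have hsymm : moment₄ r i j j i = moment₄ r i j i j := by
    simp only [moment₄]
    congr 1
    ext U
    ring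
  have hterm : ∀ k l, c i * c j * star (c k) * star (c l) * moment₄ r i j k l =
      (if k = i then if l = j then
        (c i * star (c i)) * (c j * star (c j)) * moment₄ r i j i j else 0 else 0) +
      (if k = j then if l = i then if i = j then 0 else
        (c i * star (c i)) * (c j * star (c j)) * moment₄ r i j i j else 0 else 0) := by
    intro k l
    by_cases h1 : k = i ∧ l = j
    · obtain ⟨rfl, rfl⟩ := h1
      by_cases h : k = l
      · subst h; simp only [if_true]; ring
      · simp only [if_true, if_neg h]; ring
    by_cases h2 : k = j ∧ l = i
    · obtain ⟨rfl, rfl⟩ := h2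
      by_cases h : k = l
      · exact absurd ⟨h, h.symm⟩ h1
      · simp only [if_true, if_neg h, if_neg (Ne.symm h), hsymm]; ring
    rw [moment₄_eq_zero r (by tauto)]
    by_cases h3 : k = i <;> by_cases h4 : l = j <;> by_cases h5 : k = j <;>
      by_cases h6 : l = i <;> simp_all
  simp only [hterm, Finset.sum_add_distrib, Finset.sum_ite_eq', Finset.mem_univ, if_true,
    Finset.sum_ite_irrel, Finset.sum_const_zero]
  split_ifs <;> ring

theorem sum_moment₄_pair (r : ι → ℂ) {p q : ι} (h : p ≠ q) (α β : ℝ) :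
    ∑ i, ∑ j, ∑ k, ∑ l, (Pi.single p (α : ℂ) + Pi.single q (β : ℂ) : ι → ℂ) i *
      (Pi.single p (α : ℂ) + Pi.single q (β : ℂ) : ι → ℂ) j *
      star ((Pi.single p (α : ℂ) + Pi.single q (β : ℂ) : ι → ℂ) k) *
      star ((Pi.single p (α : ℂ) + Pi.single q (β : ℂ) : ι → ℂ) l) * moment₄ r i j k l =
    α ^ 4 * moment₄ r p p p p + β ^ 4 * moment₄ r q q q q +
      4 * α ^ 2 * β ^ 2 * moment₄ r p q p q := by
  have hsymm : moment₄ r q p q p = moment₄ r p q p q := by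
    simp only [moment₄]
    congr 1
    ext U
    ring
  have hw : ∀ i, (Pi.single p (α : ℂ) + Pi.single q (β : ℂ) : ι → ℂ) i *
      star ((Pi.single p (α : ℂ) + Pi.single q (β : ℂ) : ι → ℂ) i) =
      (if i = p then (α : ℂ) ^ 2 else 0) + (if i = q then (β : ℂ) ^ 2 else 0) := by
    intro i
    rcases eq_or_ne i p with rfl | h1
    · simp [h]; ring
    · rcases eq_or_ne i q with rfl | h2
      · simp [h1]; ring
      · simp [h1, h2]
  rw [sum_moment₄]
  simp only [hw]
  simp only [mul_add, add_mul, Finset.sum_add_distrib, mul_ite, ite_mul, zero_mul, mul_zero,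
    Finset.sum_ite_eq', Finset.mem_univ, if_true,
    if_neg h, if_neg h.symm, hsymm]
  ring

/-- Phases cannot compare different coordinates; one reflection mixing two of them can. The triple
7, 24, 25 keeps it rational. The factor 2 comes from 25⁴ - 7⁴ - 24⁴ = 2·(7·24)² = 56448. -/
theorem moment₄_reflection (r : ι → ℂ) {p q : ι} (h : p ≠ q) :
    moment₄ r p p p p = moment₄ r q q q q ∧ moment₄ r p p p p = 2 * moment₄ r p q p q := by
  have hp : moment₄ r p p p p = (7 / 25) ^ 4 * moment₄ r p p p p +
      (24 / 25) ^ 4 * moment₄ r q q q q + 4 * (7 / 25) ^ 2 * (24 / 25) ^ 2 * moment₄ r p q p q := by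
    conv_lhs => rw [moment₄, ← integral_mul_left_eq_self _ (reflectionUnitary p q h)]
    simp only [(haarVec_reflectionUnitary_mul r p q h _).1]
    rw [integral_quartic_haarVec]
    have key := sum_moment₄_pair r h (7 / 25) (-24 / 25)
    push_cast at key
    rw [key]
    ring
  have hq : moment₄ r q q q q = (24 / 25) ^ 4 * moment₄ r p p p p +
      (7 / 25) ^ 4 * moment₄ r q q q q + 4 * (7 / 25) ^ 2 * (24 / 25) ^ 2 * moment₄ r p q p q := by
    conv_lhs => rw [moment₄, ← integral_mul_left_eq_self _ (reflectionUnitary p q h)]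
    simp only [(haarVec_reflectionUnitary_mul r p q h _).2]
    rw [integral_quartic_haarVec]
    have key := sum_moment₄_pair r h (-24 / 25) (-7 / 25)
    push_cast at key
    rw [key]
    ring
  constructor
  · linear_combination (625 / 1152) * hp - (625 / 1152) * hq
  · linear_combination (390625 / 56448 - 180000 / 56448) * hp + (180000 / 56448) * hq

theorem moment₄_eq (r : ι → ℂ) (hr : IsNormalized r) (i j k l : ι) :
    moment₄ r i j k l = ((if i = k then 1 else 0) * (if j = l then 1 else 0) +
      (if i = l then 1 else 0) * (if j = k then 1 else 0)) /
        ((Fintype.card ι : ℂ) * (Fintype.card ι + 1)) := by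
  have hcomm : ∀ i j, moment₄ r i j j i = moment₄ r i j i j := by
    intro i j
    simp only [moment₄]
    congr 1
    ext U
    ring
  have hD : (Fintype.card ι : ℂ) ≠ 0 := by
    have : Nonempty ι := ⟨i⟩
    exact_mod_cast Fintype.card_ne_zero
  have hD' : (Fintype.card ι : ℂ) + 1 ≠ 0 := Nat.cast_add_one_ne_zero _
  have hall : ∀ p q, moment₄ r p q p q = (if p = q then 2 else 1) * (moment₄ r i i i i / 2) := by
    intro p q
    have hp : moment₄ r p p p p = moment₄ r i i i i := by
      rcases eq_or_ne p i with rfl | h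
      · rfl
      · exact (moment₄_reflection r h).1
    rcases eq_or_ne p q with rfl | h
    · rw [hp, if_pos rfl]; ring
    · rw [if_neg h, ← hp, (moment₄_reflection r h).2]; ring
  generalize moment₄ r i i i i / 2 = m at hall
  -- The squared norm of the random vector is 1; squaring that identity fixes the one remaining
  -- constant through m(D² + D) = 1.
  have hsum : ∑ p, ∑ q, moment₄ r p q p q = 1 := by
    have hc := continuous_haarVec r
    simp only [moment₄]
    rw [Finset.sum_congr rfl fun p _ => (integral_finsetSum _ fun i _ =>
      Continuous.integrable_haarUnitary (by fun_prop)).symm]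
    rw [← integral_finsetSum _ fun i _ => Continuous.integrable_haarUnitary (by fun_prop)]
    have h1 : ∀ U, ∑ p, ∑ q, haarVec r U p * haarVec r U q * star (haarVec r U p) *
        star (haarVec r U q) = 1 := by
      intro U
      have h := sum_normSq_haarVec r hr U
      calc _ = (∑ p, haarVec r U p * star (haarVec r U p)) *
            (∑ q, haarVec r U q * star (haarVec r U q)) := by
            rw [Finset.sum_mul_sum]
            refine Finset.sum_congr rfl fun p _ => Finset.sum_congr rfl fun q _ => ?_
            ring
        _ = 1 := by rw [h, one_mul]
    simp only [h1]
    simp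
  have hval : m = 1 / ((Fintype.card ι : ℂ) * (Fintype.card ι + 1)) := by
    have h2 : ∀ p q : ι, (if p = q then (2 : ℂ) else 1) = 1 + if p = q then 1 else 0 := by
      intro p q
      split_ifs <;> norm_num
    simp only [hall, ← Finset.sum_mul, h2, Finset.sum_add_distrib, Finset.sum_ite_eq,
      Finset.mem_univ, if_true, Finset.sum_const, Finset.card_univ, nsmul_eq_mul, mul_one] at hsum
    field_simp
    linear_combination hsum
  by_cases h1 : i = k ∧ j = l
  · obtain ⟨rfl, rfl⟩ := h1
    rw [hall, hval]
    rcases eq_or_ne i j with rfl | h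
    · simp only [if_true]; ring
    · simp only [if_true, if_neg h]; ring
  by_cases h2 : i = l ∧ j = k
  · obtain ⟨rfl, rfl⟩ := h2
    have h : i ≠ j := fun h => h1 ⟨h, h.symm⟩
    rw [hcomm, hall, hval]
    simp only [if_true, if_neg h]; ring
  rw [moment₄_eq_zero r (by tauto)]
  have e1 : (if i = k then (1 : ℂ) else 0) * (if j = l then 1 else 0) = 0 := by
    rcases not_and_or.mp h1 with h | h <;> simp [h]
  have e2 : (if i = l then (1 : ℂ) else 0) * (if j = k then 1 else 0) = 0 := by
    rcases not_and_or.mp h2 with h | h <;> simp [h]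
  rw [e1, e2]; simp

/-- The two terms are the two pairings of plain with conjugated copies; they become the two spin
values. -/
theorem integral_quartic_haarVec_eq (r : ι → ℂ) (hr : IsNormalized r) (c₁ c₂ c₃ c₄ : ι → ℂ) :
    ∫ U, (∑ i, c₁ i * haarVec r U i) * (∑ i, c₂ i * haarVec r U i) *
        star (∑ i, c₃ i * haarVec r U i) * star (∑ i, c₄ i * haarVec r U i) ∂haarUnitary ι =
      1 / ((Fintype.card ι : ℂ) * (Fintype.card ι + 1)) *
        ((∑ i, c₁ i * star (c₃ i)) * (∑ i, c₂ i * star (c₄ i)) +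
          (∑ i, c₁ i * star (c₄ i)) * (∑ i, c₂ i * star (c₃ i))) := by
  rw [integral_quartic_haarVec]
  simp only [moment₄_eq r hr, ← mul_div_assoc, ← Finset.sum_div, mul_add, Finset.sum_add_distrib,
    mul_ite, mul_one, mul_zero, Finset.sum_ite_eq, Finset.mem_univ, if_true,
    Finset.sum_ite_irrel, Finset.sum_const_zero, Finset.sum_mul_sum]
  rw [one_div, inv_mul_eq_div, inv_mul_eq_div, ← add_div]
  congr 2
  · refine Finset.sum_congr rfl fun i _ => Finset.sum_congr rfl fun j _ => ?_
    ring
  · refine Finset.sum_congr rfl fun i _ => Finset.sum_congr rfl fun j _ => ?_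
    ring

end HaarMoments

/-! ### Ising sums -/

section IsingDef

variable {V : Type*}

open Classical in
/-- The Boltzmann weight of an edge in a spin configuration: `1` if the spins at its ends agree and
`x` otherwise. -/
noncomputable def edgeWeight (x : ℝ) (s : V → Bool) (e : Sym2 V) : ℝ :=
  if ∀ v ∈ e, ∀ w ∈ e, s v = s w then 1 else x

open Classical in
/-- The Ising partition function of a set of edges. -/
noncomputable def isingSum [Fintype V] (x : ℝ) (S : Finset (Sym2 V)) : ℝ :=
  ∑ s : V → Bool, ∏ e ∈ S, edgeWeight x s e

end IsingDef

/-! ### The moments of a random tensor network -/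

namespace RTN

set_option linter.unusedSectionVars false

variable {V : Type*} [Fintype V] {G : SimpleGraph V} {ext : V → ℕ} {a b d : ℕ}

open Classical in
theorem integral_law_prod (R : RTN G ext a b d)
    (f : ∀ v, Matrix.unitaryGroup (TensorIndex G ext a b d v) ℂ → ℂ) :
    ∫ U, ∏ v, f v (U v) ∂(R.law) = ∏ v, ∫ u, f v u ∂haarUnitary (TensorIndex G ext a b d v) := by
  unfold law
  rw [integral_fintype_prod_eq_prod]

open Classical in
theorem integrable_law_prod (R : RTN G ext a b d)
    (f : ∀ v, Matrix.unitaryGroup (TensorIndex G ext a b d v) ℂ → ℂ) (hf : ∀ v, Continuous (f v)) :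
    Integrable (fun U => ∏ v, f v (U v)) R.law := by
  unfold law
  exact Integrable.fintype_prod_dep fun v => (hf v).integrable_haarUnitary

/-- The entry of the tensor at `v` selected by basis states of the physical sites, the internal
edges and the logical legs. -/
def tensorEntry (x : PhysSite ext → Fin a) (z : (G.edgeSet → Fin b) × (V → Fin d)) (v : V) :
    TensorIndex G ext a b d v :=
  (fun j => x ⟨v, j⟩, z.2 v, fun w => z.1 ⟨s(v, w.1), w.2⟩)

/-- Every internal edge and every logical leg is read off at some vertex, so orthogonality at all
vertices forces the two copies in a second moment to coincide. -/
theorem tensorEntry_injective (x : PhysSite ext → Fin a)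
    (z z' : (G.edgeSet → Fin b) × (V → Fin d))
    (h : ∀ v, tensorEntry x z v = tensorEntry x z' v) : z = z' := by
  refine Prod.ext ?_ ?_
  · funext ⟨e, he⟩
    induction e with
    | _ v w =>
      have := congrArg (fun i => i.2.2 ⟨w, he⟩) (h v)
      exact this
  · funext v
    exact congrArg (fun i => i.2.1) (h v)

/-- The dimension of the space of the tensor at `v`. -/
noncomputable def tensorDim (G : SimpleGraph V) (ext : V → ℕ) (a b d : ℕ) (v : V) : ℕ :=
  Nat.card (TensorIndex G ext a b d v)

open Classical in
theorem state_eq (R : RTN G ext a b d) (U : R.Sample) (x : PhysSite ext → Fin a) :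
    R.state U x = ∑ z : (G.edgeSet → Fin b) × (V → Fin d),
      star (R.bulk z.2) * ∏ v, haarVec (R.ref v) (U v) (tensorEntry x z v) := by
  rw [Fintype.sum_prod_type]
  rfl

open Classical in
theorem integral_normSq (R : RTN G ext a b d) :
    ∫ U, R.normSq U ∂(R.law) = (a : ℝ) ^ Fintype.card (PhysSite ext) *
      ((b : ℝ) ^ Fintype.card G.edgeSet * ∏ v, (1 / (tensorDim G ext a b d v : ℝ))) := by
  have hcont : ∀ v i, Continuous fun U => haarVec (R.ref v) U i := fun v i =>
    continuous_haarVec (R.ref v) i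
  have hterm : ∀ U : R.Sample, ((R.normSq U : ℝ) : ℂ) =
      ∑ x, ∑ z : (G.edgeSet → Fin b) × (V → Fin d), ∑ z' : (G.edgeSet → Fin b) × (V → Fin d),
        star (R.bulk z.2) * R.bulk z'.2 *
          ∏ v, (haarVec (R.ref v) (U v) (tensorEntry x z v) *
            star (haarVec (R.ref v) (U v) (tensorEntry x z' v))) := by
    intro U
    rw [normSq]
    push_cast
    refine Finset.sum_congr rfl fun x _ => ?_
    rw [← Complex.mul_conj', state_eq, ← Complex.star_def, star_sum, Finset.sum_mul_sum]
    refine Finset.sum_congr rfl fun z _ => Finset.sum_congr rfl fun z' _ => ?_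
    rw [star_mul', star_star, star_prod, Finset.prod_mul_distrib]
    ring
  have hint : ∀ (x : PhysSite ext → Fin a) (z z' : (G.edgeSet → Fin b) × (V → Fin d)),
      Integrable (fun U : R.Sample => star (R.bulk z.2) * R.bulk z'.2 *
          ∏ v, (haarVec (R.ref v) (U v) (tensorEntry x z v) *
            star (haarVec (R.ref v) (U v) (tensorEntry x z' v)))) R.law := by
    intro x z z'
    refine Integrable.const_mul ?_ _
    exact R.integrable_law_prod (fun v u => haarVec (R.ref v) u (tensorEntry x z v) *
            star (haarVec (R.ref v) u (tensorEntry x z' v))) fun v => by fun_prop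
  have hval : ∀ (x : PhysSite ext → Fin a) (z z' : (G.edgeSet → Fin b) × (V → Fin d)),
      ∫ U : R.Sample, star (R.bulk z.2) * R.bulk z'.2 *
          ∏ v, (haarVec (R.ref v) (U v) (tensorEntry x z v) *
            star (haarVec (R.ref v) (U v) (tensorEntry x z' v))) ∂(R.law) =
      if z = z' then star (R.bulk z.2) * R.bulk z.2 *
        ∏ v, (1 / (tensorDim G ext a b d v : ℂ)) else 0 := by
    intro x z z'
    rw [integral_const_mul, R.integral_law_prod (fun v u =>
      haarVec (R.ref v) u (tensorEntry x z v) * star (haarVec (R.ref v) u (tensorEntry x z' v)))]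
    have h : ∀ v, ∫ u, haarVec (R.ref v) u (tensorEntry x z v) *
        star (haarVec (R.ref v) u (tensorEntry x z' v)) ∂haarUnitary (TensorIndex G ext a b d v) =
        if tensorEntry x z v = tensorEntry x z' v then
          1 / (tensorDim G ext a b d v : ℂ) else 0 := by
      intro v
      rw [tensorDim, Nat.card_eq_fintype_card]
      exact moment₂_eq _ (R.ref_normalized v) _ _
    rw [Finset.prod_congr rfl fun v _ => h v, Finset.prod_ite_zero]
    by_cases hz : z = z'
    · subst hz; simp
    · rw [if_neg hz, if_neg, mul_zero]
      exact fun h => hz (tensorEntry_injective x z z' fun v => h v (Finset.mem_univ v))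
  have hbulk : ∑ β, star (R.bulk β) * R.bulk β = 1 := by
    have := R.bulk_normalized
    unfold IsNormalized at this
    rw [← Complex.ofReal_one, ← this]
    push_cast
    exact Finset.sum_congr rfl fun β _ => Complex.conj_mul' _
  have main : ((∫ U, R.normSq U ∂(R.law) : ℝ) : ℂ) = (a : ℂ) ^ Fintype.card (PhysSite ext) *
      ((b : ℂ) ^ Fintype.card G.edgeSet * ∏ v, (1 / (tensorDim G ext a b d v : ℂ))) := by
    rw [← integral_complex_ofReal]
    simp_rw [hterm]
    rw [integral_finsetSum _ fun x _ => integrable_finsetSum _ fun z _ =>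
      integrable_finsetSum _ fun z' _ => hint x z z']
    have hx : ∀ x : PhysSite ext → Fin a, ∫ U : R.Sample, ∑ z, ∑ z', star (R.bulk z.2) *
        R.bulk z'.2 * ∏ v, (haarVec (R.ref v) (U v) (tensorEntry x z v) *
            star (haarVec (R.ref v) (U v) (tensorEntry x z' v))) ∂(R.law) =
        (b : ℂ) ^ Fintype.card G.edgeSet * ∏ v, (1 / (tensorDim G ext a b d v : ℂ)) := by
      intro x
      rw [integral_finsetSum _ fun z _ => integrable_finsetSum _ fun z' _ => hint x z z']
      rw [Finset.sum_congr rfl fun z _ => integral_finsetSum _ fun z' _ => hint x z z']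
      simp only [hval, Finset.sum_ite_eq, Finset.mem_univ, if_true]
      rw [← Finset.sum_mul, Fintype.sum_prod_type]
      simp only [hbulk]
      simp
    rw [Finset.sum_congr rfl fun x _ => hx x]
    simp
  apply Complex.ofReal_injective
  rw [main]
  push_cast
  rfl

/-- The functional `⟨φ| ⟨Φ|` at the vertex `v`, for product vectors, combined with a basis state of
the internal edges. -/
noncomputable def legFunctional (f : V → Fin d → ℂ) (g : PhysSite ext → Fin a → ℂ)
    (e : G.edgeSet → Fin b) (v : V) (i : TensorIndex G ext a b d v) : ℂ :=
  open Classical in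
  if i.2.2 = (fun w => e ⟨s(v, w.1), w.2⟩) then
    star (f v i.2.1) * ∏ j, star (g ⟨v, j⟩ (i.1 j)) else 0

open Classical in
-- Normalization of the one-site vectors sums the physical and logical legs to 1, leaving only the
-- matching of internal legs. This removes all dependence on Φ and φ.
theorem sum_legFunctional (f : V → Fin d → ℂ) (g : PhysSite ext → Fin a → ℂ)
    (hf : ∀ v, IsNormalized (f v)) (hg : ∀ v, IsNormalized (g v))
    (e e' : G.edgeSet → Fin b) (v : V) :
    ∑ i, legFunctional f g e v i * star (legFunctional f g e' v i) =
      if ∀ w (h : G.Adj v w), e ⟨s(v, w), h⟩ = e' ⟨s(v, w), h⟩ then 1 else 0 := by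
  have hn : ∀ {n : ℕ} (h : Fin n → ℂ), IsNormalized h → ∑ i, star (h i) * h i = 1 := by
    intro n h hh
    unfold IsNormalized at hh
    rw [← Complex.ofReal_one, ← hh]
    push_cast
    exact Finset.sum_congr rfl fun β _ => Complex.conj_mul' _
  have hee : (∀ w (h : G.Adj v w), e ⟨s(v, w), h⟩ = e' ⟨s(v, w), h⟩) ↔
      (fun w : G.neighborSet v => e' ⟨s(v, w.1), w.2⟩) = (fun w => e ⟨s(v, w.1), w.2⟩) := by
    constructor
    · intro h; funext w; exact (h w.1 w.2).symm
    · intro h w hw; exact (congrFun h ⟨w, hw⟩).symm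
  rw [Fintype.sum_prod_type]
  simp only [Fintype.sum_prod_type, legFunctional, ite_mul, zero_mul, Finset.sum_ite_eq',
    Finset.mem_univ, if_true, hee, apply_ite star, star_zero, mul_ite, mul_zero]
  split_ifs with h
  · simp only [star_mul', star_star, star_prod]
    have h1 : ∀ (y : Fin (ext v) → Fin a) (β : Fin d),
        star (f v β) * (∏ j, star (g ⟨v, j⟩ (y j))) * (f v β * ∏ j, g ⟨v, j⟩ (y j)) =
        (∏ j, star (g ⟨v, j⟩ (y j)) * g ⟨v, j⟩ (y j)) * (star (f v β) * f v β) := by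
      intro y β
      rw [Finset.prod_mul_distrib]; ring
    simp only [h1, ← Finset.mul_sum, hn _ (hf v), mul_one]
    rw [← Fintype.piFinset_univ, ← Finset.prod_univ_sum (fun _ => Finset.univ)
      (fun j i => star (g ⟨v, j⟩ i) * g ⟨v, j⟩ i)]
    simp only [hn _ (hg _), Finset.prod_const_one]
  · simp

open Classical in
-- After conjugation the tensors enter linearly, and the product form lets the physical and logical
-- sums factor over the vertices; only the internal edges still couple them.
theorem star_overlap_eq (R : RTN G ext a b d) (f : V → Fin d → ℂ) (g : PhysSite ext → Fin a → ℂ)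
    (hf : ∀ β, R.bulk β = ∏ v, f v (β v)) (hg : ∀ x, R.bdy x = ∏ s, g s (x s)) (U : R.Sample) :
    star (R.overlap U) = ∑ e : G.edgeSet → Fin b,
      ∏ v, ∑ i, legFunctional f g e v i * haarVec (R.ref v) (U v) i := by
  have h : ∀ e : G.edgeSet → Fin b,
      ∏ v, ∑ i, legFunctional f g e v i * haarVec (R.ref v) (U v) i =
      ∑ x : PhysSite ext → Fin a, ∑ β : V → Fin d, star (R.bdy x) * (star (R.bulk β) *
        ∏ v, haarVec (R.ref v) (U v) (tensorEntry x (e, β) v)) := by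
    intro e
    have h1 : ∀ v, ∑ i, legFunctional f g e v i * haarVec (R.ref v) (U v) i =
        ∑ i : (Fin (ext v) → Fin a) × Fin d, (∏ j, star (g ⟨v, j⟩ (i.1 j))) * (star (f v i.2) *
          haarVec (R.ref v) (U v) (i.1, i.2, fun w => e ⟨s(v, w.1), w.2⟩)) := by
      intro v
      rw [Fintype.sum_prod_type, Fintype.sum_prod_type]
      simp only [Fintype.sum_prod_type, legFunctional, ite_mul, zero_mul, Finset.sum_ite_eq',
        Finset.mem_univ, if_true]
      refine Finset.sum_congr rfl fun y _ => Finset.sum_congr rfl fun β _ => ?_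
      ring
    rw [Finset.prod_congr rfl fun v _ => h1 v, Finset.prod_univ_sum, Fintype.piFinset_univ,
      ← Fintype.sum_prod_type']
    refine (Fintype.sum_equiv (((Equiv.piCurry fun _ _ => Fin a).prodCongr (Equiv.refl _)).trans
      (Equiv.arrowProdEquivProdArrow V _ _).symm) _ _ fun z => ?_).symm
    rw [hf, hg, Finset.prod_mul_distrib, Finset.prod_mul_distrib, star_prod, star_prod,
      Fintype.prod_sigma]
    rfl
  rw [Finset.sum_congr rfl fun e _ => h e, Finset.sum_comm]
  rw [overlap, star_sum]
  refine Finset.sum_congr rfl fun x _ => ?_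
  rw [star_mul', star_star, mul_comm, state_eq, Fintype.sum_prod_type, Finset.mul_sum]
  refine Finset.sum_congr rfl fun e _ => ?_
  rw [Finset.mul_sum]

theorem ite_and_one_zero (p q : Prop) [Decidable p] [Decidable q] [Decidable (p ∧ q)] :
    (if p ∧ q then (1 : ℂ) else 0) = (if p then 1 else 0) * (if q then 1 else 0) := by
  by_cases hp : p <;> by_cases hq : q <;> simp [hp, hq]

/-- The condition that a pairing of the four replicas of an edge, the identity or the swap, imposes
on their basis states. -/
def IsPaired (σ : Bool) (r : Fin b × Fin b × Fin b × Fin b) : Prop :=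
  if σ then r.1 = r.2.2.1 ∧ r.2.1 = r.2.2.2 else r.1 = r.2.2.2 ∧ r.2.1 = r.2.2.1

open Classical in
-- One pairing imposes two equations on four indices and leaves b² choices; two different pairings
-- force all four indices to be equal.
theorem sum_isPaired (σ τ : Bool) :
    ∑ r : Fin b × Fin b × Fin b × Fin b, (if IsPaired σ r ∧ IsPaired τ r then (1 : ℂ) else 0) =
      if σ = τ then (b : ℂ) ^ 2 else b := by
  have h1 : ∀ r : Fin b × Fin b × Fin b × Fin b, (if IsPaired true r then (1 : ℂ) else 0) =
      if r.2.2.1 = r.1 then if r.2.2.2 = r.2.1 then 1 else 0 else 0 := by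
    intro r
    rw [← ite_and]
    congr 1
    simp [IsPaired, eq_comm]
  have h2 : ∀ r : Fin b × Fin b × Fin b × Fin b, (if IsPaired false r then (1 : ℂ) else 0) =
      if r.2.2.2 = r.1 then if r.2.2.1 = r.2.1 then 1 else 0 else 0 := by
    intro r
    rw [← ite_and]
    congr 1
    simp [IsPaired, eq_comm]
  have h3 : ∀ r : Fin b × Fin b × Fin b × Fin b,
      (if IsPaired true r ∧ IsPaired false r then (1 : ℂ) else 0) =
      if r.2.2.2 = r.1 then if r.2.2.1 = r.1 then if r.2.1 = r.1 then 1 else 0 else 0 else 0 := by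
    intro r
    rw [← ite_and, ← ite_and]
    congr 1
    simp only [IsPaired, if_true, eq_iff_iff, Bool.false_eq_true, if_false]
    grind
  cases σ <;> cases τ
  · simp only [and_self, h2, Fintype.sum_prod_type]
    simp [sq]
  · simp only [and_comm (a := IsPaired false _), h3, Fintype.sum_prod_type]
    simp
  · simp only [h3, Fintype.sum_prod_type]
    simp
  · simp only [and_self, h1, Fintype.sum_prod_type]
    simp [sq]

open Classical in
theorem sum_replicas (hb : b ≠ 0) (s : V → Bool) :
    ∑ e : G.edgeSet → Fin b × Fin b × Fin b × Fin b,
      (if ∀ v w (h : G.Adj v w), IsPaired (s v) (e ⟨s(v, w), h⟩) then (1 : ℂ) else 0) =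
    (b : ℂ) ^ (2 * Fintype.card G.edgeSet) * (∏ e ∈ G.edgeFinset, edgeWeight (1 / b) s e : ℝ) := by
  have h1 : ∀ e : G.edgeSet → Fin b × Fin b × Fin b × Fin b,
      (if ∀ v w (h : G.Adj v w), IsPaired (s v) (e ⟨s(v, w), h⟩) then (1 : ℂ) else 0) =
      ∏ ε : G.edgeSet, if ∀ v ∈ ε.1, IsPaired (s v) (e ε) then 1 else 0 := by
    intro e
    rw [Finset.prod_ite_zero]
    simp only [Finset.prod_const_one, Finset.mem_univ, true_imp_iff]
    congr 1
    rw [eq_iff_iff]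
    constructor
    · rintro h ⟨ε, hε⟩ v hv
      obtain ⟨w, rfl⟩ := hv
      exact h v w hε
    · intro h v w hvw
      exact h ⟨s(v, w), hvw⟩ v (Sym2.mem_mk_left v w)
  have h2 : ∀ ε : G.edgeSet, ∑ r : Fin b × Fin b × Fin b × Fin b,
      (if ∀ v ∈ ε.1, IsPaired (s v) r then (1 : ℂ) else 0) =
      (b : ℂ) ^ 2 * (edgeWeight (1 / b) s ε.1 : ℝ) := by
    rintro ⟨ε, hε⟩
    induction ε with
    | _ v w =>
      have hb' : (b : ℂ) ≠ 0 := by exact_mod_cast hb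
      simp only [Sym2.mem_iff, forall_eq_or_imp, forall_eq, sum_isPaired, edgeWeight]
      by_cases h : s v = s w
      · simp [h]
      · simp only [h, Ne.symm h, if_false, and_false, false_and]
        push_cast
        field_simp
  simp only [h1]
  rw [← Fintype.piFinset_univ, ← Finset.prod_univ_sum (fun _ => Finset.univ)
    (fun (ε : G.edgeSet) r => if ∀ v ∈ ε.1, IsPaired (s v) r then (1 : ℂ) else 0)]
  simp only [h2]
  rw [Finset.prod_mul_distrib, Finset.prod_const, ← pow_mul, Finset.card_univ]
  congr 1
  push_cast
  rw [← Finset.prod_coe_sort G.edgeFinset]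
  exact Fintype.prod_equiv (Equiv.subtypeEquivRight fun e => by simp) _ _ fun _ => rfl

open Classical in
theorem integral_overlap (R : RTN G ext a b d) (hb : b ≠ 0) (hR : R.Unentangled) :
    ∫ U, ‖R.overlap U‖ ^ 4 ∂(R.law) =
      (∏ v, (1 / ((tensorDim G ext a b d v : ℝ) * (tensorDim G ext a b d v + 1)))) *
        ((b : ℝ) ^ (2 * Fintype.card G.edgeSet) * isingSum (1 / b) G.edgeFinset) := by
  obtain ⟨⟨f, hf, hfΦ⟩, ⟨g, hg, hgφ⟩⟩ := hR
  have hcont : ∀ v i, Continuous fun U => haarVec (R.ref v) U i := fun v i =>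
    continuous_haarVec (R.ref v) i
  set A : (G.edgeSet → Fin b) → ∀ v, Matrix.unitaryGroup (TensorIndex G ext a b d v) ℂ → ℂ :=
    fun e v u => ∑ i, legFunctional f g e v i * haarVec (R.ref v) u i with hA
  have hAcont : ∀ e v, Continuous (A e v) := fun e v => by simp only [hA]; fun_prop
  set F : (G.edgeSet → Fin b × Fin b × Fin b × Fin b) → ∀ v,
      Matrix.unitaryGroup (TensorIndex G ext a b d v) ℂ → ℂ :=
    fun e v u => A (fun ε => (e ε).1) v u * A (fun ε => (e ε).2.1) v u *
      star (A (fun ε => (e ε).2.2.1) v u) * star (A (fun ε => (e ε).2.2.2) v u) with hF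
  have hFcont : ∀ e v, Continuous (F e v) := fun e v => by
    have := hAcont
    simp only [hF]; fun_prop
  have hterm : ∀ U : R.Sample, ((‖R.overlap U‖ ^ 4 : ℝ) : ℂ) =
      ∑ e : G.edgeSet → Fin b × Fin b × Fin b × Fin b, ∏ v, F e v (U v) := by
    intro U
    have h1 : ((‖R.overlap U‖ ^ 4 : ℝ) : ℂ) = star (R.overlap U) * star (R.overlap U) *
        star (star (R.overlap U)) * star (star (R.overlap U)) := by
      have := Complex.conj_mul' (R.overlap U)
      rw [star_star, Complex.star_def]
      push_cast
      linear_combination (-((starRingEnd ℂ) (R.overlap U) * R.overlap U) -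
        (‖R.overlap U‖ : ℂ) ^ 2) * this
    have hov : star (R.overlap U) = ∑ e, ∏ v, A e v (U v) := R.star_overlap_eq f g hfΦ hgφ U
    rw [h1, hov, star_sum]
    symm
    rw [Fintype.sum_equiv ((Equiv.arrowProdEquivProdArrow _ _ _).trans ((Equiv.refl _).prodCongr
      ((Equiv.arrowProdEquivProdArrow _ _ _).trans ((Equiv.refl _).prodCongr
        (Equiv.arrowProdEquivProdArrow _ _ _))))) _
      (fun q : (G.edgeSet → Fin b) × (G.edgeSet → Fin b) × (G.edgeSet → Fin b) ×
        (G.edgeSet → Fin b) => (∏ v, A q.1 v (U v)) * (∏ v, A q.2.1 v (U v)) *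
        star (∏ v, A q.2.2.1 v (U v)) * star (∏ v, A q.2.2.2 v (U v))) fun e => by
          simp only [hF, Finset.prod_mul_distrib, star_prod]; rfl]
    simp only [Fintype.sum_prod_type, ← Finset.mul_sum, ← Finset.sum_mul]
  -- The two terms of the Haar formula are written as a sum over a spin, so that expanding the
  -- product over vertices produces a sum over spin configurations.
  have hint : ∀ e v, ∫ u, F e v u ∂haarUnitary (TensorIndex G ext a b d v) =
      1 / ((tensorDim G ext a b d v : ℂ) * (tensorDim G ext a b d v + 1)) *
        ∑ σ : Bool, (if ∀ w (h : G.Adj v w), IsPaired σ (e ⟨s(v, w), h⟩) then 1 else 0) := by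
    intro e v
    simp only [hF, hA]
    rw [integral_quartic_haarVec_eq _ (R.ref_normalized v), tensorDim, Nat.card_eq_fintype_card]
    simp only [sum_legFunctional f g hf hg, Fintype.sum_bool, ← ite_and_one_zero, IsPaired,
      forall_and, if_true, Bool.false_eq_true, if_false]
  have main : ((∫ U, ‖R.overlap U‖ ^ 4 ∂(R.law) : ℝ) : ℂ) =
      (∏ v, (1 / ((tensorDim G ext a b d v : ℂ) * (tensorDim G ext a b d v + 1)))) *
        ((b : ℂ) ^ (2 * Fintype.card G.edgeSet) * (isingSum (1 / b) G.edgeFinset : ℝ)) := by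
    rw [← integral_complex_ofReal]
    simp_rw [hterm]
    rw [integral_finsetSum _ fun e _ => R.integrable_law_prod (F e) (hFcont e)]
    simp only [R.integral_law_prod, hint, Finset.prod_mul_distrib]
    rw [← Finset.mul_sum]
    congr 1
    simp only [Finset.prod_univ_sum, Fintype.piFinset_univ, Finset.prod_ite_zero,
      Finset.prod_const_one, Finset.mem_univ, true_imp_iff]
    rw [Finset.sum_comm]
    simp only [sum_replicas hb]
    rw [← Finset.mul_sum, isingSum]
    push_cast
    rfl
  apply Complex.ofReal_injective
  rw [main]
  push_cast
  rfl

open Classical in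
-- The powers of b cancel, a^n/a^(2n) leaves a^(-n), and each vertex contributes D²/(D(D+1)).
theorem invEffDim_eq (R : RTN G ext a b d) (ha : a ≠ 0) (hb : b ≠ 0) (hd : d ≠ 0)
    (hR : R.Unentangled) :
    R.invEffDim = ((a : ℝ) ^ Fintype.card (PhysSite ext))⁻¹ *
      (∏ v, ((tensorDim G ext a b d v : ℝ) / (tensorDim G ext a b d v + 1))) *
        isingSum (1 / b) G.edgeFinset := by
  rw [invEffDim, integral_normSq, R.integral_overlap hb hR]
  have hD : ∀ v, (tensorDim G ext a b d v : ℝ) ≠ 0 := by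
    intro v
    have := NeZero.mk ha
    have := NeZero.mk hb
    have := NeZero.mk hd
    simp [tensorDim, hb, ha, hd]
  have hprod : (∏ v, ((tensorDim G ext a b d v : ℝ) / (tensorDim G ext a b d v + 1))) *
      (∏ v, (1 / (tensorDim G ext a b d v : ℝ))) ^ 2 =
      ∏ v, (1 / ((tensorDim G ext a b d v : ℝ) * (tensorDim G ext a b d v + 1))) := by
    rw [← Finset.prod_pow, ← Finset.prod_mul_distrib]
    refine Finset.prod_congr rfl fun v _ => ?_
    have := hD v
    have h' : (tensorDim G ext a b d v : ℝ) + 1 ≠ 0 := by positivity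
    field_simp
  rw [← hprod]
  have h0 : ∏ v, (1 / (tensorDim G ext a b d v : ℝ)) ≠ 0 :=
    Finset.prod_ne_zero_iff.mpr fun v _ => one_div_ne_zero (hD v)
  have ha' : (a : ℝ) ≠ 0 := by exact_mod_cast ha
  have hb' : (b : ℝ) ≠ 0 := by exact_mod_cast hb
  field_simp
  ring

end RTN

/-! ### Bounds for Ising sums -/

section IsingBounds

set_option linter.unusedSectionVars false

variable {V : Type*}

theorem edgeWeight_mk (x : ℝ) (s : V → Bool) (u v : V) :
    edgeWeight x s s(u, v) = if s u = s v then 1 else x := by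
  unfold edgeWeight
  congr 1
  simp only [Sym2.mem_iff, forall_eq_or_imp, forall_eq, eq_iff_iff]
  grind

theorem edgeWeight_nonneg {x : ℝ} (hx : 0 ≤ x) (s : V → Bool) (e : Sym2 V) :
    0 ≤ edgeWeight x s e := by
  unfold edgeWeight; split_ifs <;> simp [hx]

theorem edgeWeight_le_one {x : ℝ} (hx : x ≤ 1) (s : V → Bool) (e : Sym2 V) :
    edgeWeight x s e ≤ 1 := by
  unfold edgeWeight; split_ifs <;> simp [hx]

theorem le_edgeWeight {x : ℝ} (hx : x ≤ 1) (s : V → Bool) (e : Sym2 V) :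
    x ≤ edgeWeight x s e := by
  unfold edgeWeight; split_ifs <;> simp [hx]

open Classical in
theorem edgeWeight_update (x : ℝ) (s : V → Bool) (v : V) (c : Bool) (e : Sym2 V) (h : v ∉ e) :
    edgeWeight x (Function.update s v c) e = edgeWeight x s e := by
  induction e with
  | _ u w =>
    rw [Sym2.mem_iff, not_or] at h
    rw [edgeWeight_mk, edgeWeight_mk, Function.update_of_ne (Ne.symm h.1),
      Function.update_of_ne (Ne.symm h.2)]

variable [Fintype V]

open Classical in
-- Flipping the spin at v permutes the configurations. This sums out one spin while keeping the
-- vertex set fixed.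
theorem two_mul_sum_spin (F : (V → Bool) → ℝ) (v : V) :
    2 * ∑ s, F s = ∑ s, (F (Function.update s v true) + F (Function.update s v false)) := by
  have hinv : Function.Involutive fun s : V → Bool => Function.update s v (!s v) := by
    intro s; simp
  have h1 : ∑ s, F (Function.update s v (!s v)) = ∑ s, F s :=
    Equiv.sum_comp hinv.toPerm F
  rw [two_mul]
  nth_rewrite 2 [← h1]
  rw [← Finset.sum_add_distrib]
  refine Finset.sum_congr rfl fun s _ => ?_
  have h : Function.update s v (s v) = s := Function.update_eq_self v s
  cases hs : s v
  · rw [hs] at h; rw [h, add_comm]; simp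
  · rw [hs] at h; rw [h]; simp

theorem isingSum_nonneg {x : ℝ} (hx : 0 ≤ x) (S : Finset (Sym2 V)) : 0 ≤ isingSum x S :=
  Finset.sum_nonneg fun _ _ => Finset.prod_nonneg fun _ _ => edgeWeight_nonneg hx _ _

theorem isingSum_anti {x : ℝ} (hx : 0 ≤ x) (hx1 : x ≤ 1) {S T : Finset (Sym2 V)} (h : S ⊆ T) :
    isingSum x T ≤ isingSum x S :=
  Finset.sum_le_sum fun s _ => by
    classical
    rw [← Finset.prod_sdiff h]
    exact mul_le_of_le_one_left (Finset.prod_nonneg fun _ _ => edgeWeight_nonneg hx _ _)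
      (Finset.prod_le_one (fun _ _ => edgeWeight_nonneg hx _ _) fun _ _ => edgeWeight_le_one hx1 _ _)

theorem isingSum_empty (x : ℝ) : isingSum x (∅ : Finset (Sym2 V)) = 2 ^ Fintype.card V := by
  classical
  simp [isingSum]

theorem mul_isingSum_le_insert [DecidableEq (Sym2 V)] {x : ℝ} (hx : 0 ≤ x) (hx1 : x ≤ 1) (e : Sym2 V)
    (S : Finset (Sym2 V)) : x * isingSum x S ≤ isingSum x (insert e S) := by
  by_cases he : e ∈ S
  · rw [Finset.insert_eq_of_mem he]
    exact mul_le_of_le_one_left (isingSum_nonneg hx S) hx1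
  · rw [isingSum, isingSum, Finset.mul_sum]
    refine Finset.sum_le_sum fun s _ => ?_
    rw [Finset.prod_insert he]
    exact mul_le_mul_of_nonneg_right (le_edgeWeight hx1 s e)
      (Finset.prod_nonneg fun _ _ => edgeWeight_nonneg hx _ _)

open Classical in
theorem prod_edgeWeight_update (x : ℝ) (s : V → Bool) (v : V) (c : Bool) (S : Finset (Sym2 V))
    (h : ∀ e ∈ S, v ∉ e) :
    ∏ e ∈ S, edgeWeight x (Function.update s v c) e = ∏ e ∈ S, edgeWeight x s e :=
  Finset.prod_congr rfl fun e he => edgeWeight_update x s v c e (h e he)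

/-- A pendant edge multiplies the Ising sum, normalized by the number of configurations, by
`(1 + x) / 2`. -/
theorem isingSum_insert_pendant [DecidableEq (Sym2 V)] (x : ℝ) (S : Finset (Sym2 V)) {u v : V} (huv : u ≠ v)
    (hv : ∀ e ∈ S, v ∉ e) : 2 * isingSum x (insert s(u, v) S) = (1 + x) * isingSum x S := by
  classical
  have hnot : s(u, v) ∉ S := fun h => hv _ h (Sym2.mem_mk_right u v)
  rw [isingSum, two_mul_sum_spin _ v, isingSum, Finset.mul_sum]
  refine Finset.sum_congr rfl fun s _ => ?_
  rw [Finset.prod_insert hnot, Finset.prod_insert hnot, prod_edgeWeight_update _ _ _ _ _ hv,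
    prod_edgeWeight_update _ _ _ _ _ hv, edgeWeight_mk, edgeWeight_mk]
  simp only [Function.update_self, Function.update_of_ne huv]
  cases s u <;> simp <;> ring

open Classical in
-- Summing out the two inner spins is the third power of the 2×2 transfer matrix: 1 + 3x² for equal
-- end spins and 3x + x³ for unequal ones. The difference is (1 - x)³, so equal ends are the worst
-- case.
theorem isingSum_insert_path₂ {x : ℝ} (hx : 0 ≤ x) (hx1 : x ≤ 1) (S : Finset (Sym2 V))
    {u v₁ v₂ w : V} (h12 : v₁ ≠ v₂) (hu1 : u ≠ v₁) (hu2 : u ≠ v₂) (hw1 : w ≠ v₁) (hw2 : w ≠ v₂)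
    (hv₁ : ∀ e ∈ S, v₁ ∉ e) (hv₂ : ∀ e ∈ S, v₂ ∉ e) :
    4 * isingSum x (insert s(u, v₁) (insert s(v₁, v₂) (insert s(v₂, w) S))) ≤
      (1 + 3 * x ^ 2) * isingSum x S := by
  have n1 : s(v₂, w) ∉ S := fun h => hv₂ _ h (Sym2.mem_mk_left _ _)
  have n2 : s(v₁, v₂) ∉ insert s(v₂, w) S := by
    rw [Finset.mem_insert, not_or]
    refine ⟨?_, fun h => hv₁ _ h (Sym2.mem_mk_left _ _)⟩
    rw [Sym2.eq_iff]; tauto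
  have n3 : s(u, v₁) ∉ insert s(v₁, v₂) (insert s(v₂, w) S) := by
    simp only [Finset.mem_insert, not_or]
    refine ⟨?_, ?_, fun h => hv₁ _ h (Sym2.mem_mk_right _ _)⟩ <;> rw [Sym2.eq_iff] <;> tauto
  have hexp : ∀ s : V → Bool,
      ∏ e ∈ insert s(u, v₁) (insert s(v₁, v₂) (insert s(v₂, w) S)), edgeWeight x s e =
      (if s u = s v₁ then 1 else x) * ((if s v₁ = s v₂ then 1 else x) *
        ((if s v₂ = s w then 1 else x) * ∏ e ∈ S, edgeWeight x s e)) := by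
    intro s
    rw [Finset.prod_insert n3, Finset.prod_insert n2, Finset.prod_insert n1, edgeWeight_mk,
      edgeWeight_mk, edgeWeight_mk]
  have h4 : ∀ y : ℝ, 4 * y = 2 * (2 * y) := fun y => by ring
  rw [isingSum, h4, two_mul_sum_spin _ v₁, two_mul_sum_spin _ v₂, isingSum, Finset.mul_sum]
  refine Finset.sum_le_sum fun s _ => ?_
  simp only [hexp, prod_edgeWeight_update _ _ _ _ _ hv₁, prod_edgeWeight_update _ _ _ _ _ hv₂,
    Function.update_self, Function.update_of_ne hu1, Function.update_of_ne hu2,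
    Function.update_of_ne hw1, Function.update_of_ne hw2, Function.update_of_ne h12.symm]
  have hP : 0 ≤ ∏ e ∈ S, edgeWeight x s e := Finset.prod_nonneg fun _ _ => edgeWeight_nonneg hx _ _
  generalize ∏ e ∈ S, edgeWeight x s e = P at hP
  have hcube : 0 ≤ (1 - x) ^ 3 * P := mul_nonneg (pow_nonneg (by linarith) 3) hP
  cases s u <;> cases s w <;> simp <;> nlinarith

open Classical in
-- The fourth power of the transfer matrix has entries 1 + 6x² + x⁴ and 4x + 4x³, with difference (1
-- - x)⁴.
theorem isingSum_insert_path₃ {x : ℝ} (hx : 0 ≤ x) (S : Finset (Sym2 V))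
    {u v₁ v₂ v₃ w : V} (h12 : v₁ ≠ v₂) (h13 : v₁ ≠ v₃) (h23 : v₂ ≠ v₃)
    (hu1 : u ≠ v₁) (hu2 : u ≠ v₂) (hu3 : u ≠ v₃) (hw1 : w ≠ v₁) (hw2 : w ≠ v₂) (hw3 : w ≠ v₃)
    (hv₁ : ∀ e ∈ S, v₁ ∉ e) (hv₂ : ∀ e ∈ S, v₂ ∉ e) (hv₃ : ∀ e ∈ S, v₃ ∉ e) :
    8 * isingSum x (insert s(u, v₁) (insert s(v₁, v₂) (insert s(v₂, v₃) (insert s(v₃, w) S)))) ≤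
      (1 + 6 * x ^ 2 + x ^ 4) * isingSum x S := by
  have n1 : s(v₃, w) ∉ S := fun h => hv₃ _ h (Sym2.mem_mk_left _ _)
  have n2 : s(v₂, v₃) ∉ insert s(v₃, w) S := by
    rw [Finset.mem_insert, not_or]
    refine ⟨?_, fun h => hv₂ _ h (Sym2.mem_mk_left _ _)⟩
    rw [Sym2.eq_iff]; tauto
  have n3 : s(v₁, v₂) ∉ insert s(v₂, v₃) (insert s(v₃, w) S) := by
    simp only [Finset.mem_insert, not_or]
    refine ⟨?_, ?_, fun h => hv₁ _ h (Sym2.mem_mk_left _ _)⟩ <;> rw [Sym2.eq_iff] <;> tauto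
  have n4 : s(u, v₁) ∉ insert s(v₁, v₂) (insert s(v₂, v₃) (insert s(v₃, w) S)) := by
    simp only [Finset.mem_insert, not_or]
    refine ⟨?_, ?_, ?_, fun h => hv₁ _ h (Sym2.mem_mk_right _ _)⟩ <;> rw [Sym2.eq_iff] <;> tauto
  have hexp : ∀ s : V → Bool,
      ∏ e ∈ insert s(u, v₁) (insert s(v₁, v₂) (insert s(v₂, v₃) (insert s(v₃, w) S))),
        edgeWeight x s e =
      (if s u = s v₁ then 1 else x) * ((if s v₁ = s v₂ then 1 else x) *
        ((if s v₂ = s v₃ then 1 else x) *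
        ((if s v₃ = s w then 1 else x) * ∏ e ∈ S, edgeWeight x s e))) := by
    intro s
    rw [Finset.prod_insert n4, Finset.prod_insert n3, Finset.prod_insert n2, Finset.prod_insert n1,
      edgeWeight_mk, edgeWeight_mk, edgeWeight_mk, edgeWeight_mk]
  have h8 : ∀ y : ℝ, 8 * y = 2 * (2 * (2 * y)) := fun y => by ring
  rw [isingSum, h8, two_mul_sum_spin _ v₁, two_mul_sum_spin _ v₂, two_mul_sum_spin _ v₃, isingSum,
    Finset.mul_sum]
  refine Finset.sum_le_sum fun s _ => ?_
  simp only [hexp, prod_edgeWeight_update _ _ _ _ _ hv₁, prod_edgeWeight_update _ _ _ _ _ hv₂,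
    prod_edgeWeight_update _ _ _ _ _ hv₃,
    Function.update_self, Function.update_of_ne hu1, Function.update_of_ne hu2,
    Function.update_of_ne hu3, Function.update_of_ne hw1, Function.update_of_ne hw2,
    Function.update_of_ne hw3, Function.update_of_ne h12.symm, Function.update_of_ne h13.symm,
    Function.update_of_ne h23.symm]
  have hP : 0 ≤ ∏ e ∈ S, edgeWeight x s e := Finset.prod_nonneg fun _ _ => edgeWeight_nonneg hx _ _
  generalize ∏ e ∈ S, edgeWeight x s e = P at hP
  have hfour : 0 ≤ (1 - x) ^ 4 * P := by positivity
  cases s u <;> cases s w <;> simp <;> nlinarith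

/-- The graph on the vertices in `A`, of which there are `m`, has an Ising sum of at most
`2 (1 + x) ^ (k / 2)`. -/
def IsingBound (x : ℝ) (G : SimpleGraph V) (A : Set V) (m k : ℕ) : Prop :=
  ∃ S : Finset (Sym2 V), (∀ e ∈ S, e ∈ G.edgeSet ∧ ∀ v ∈ e, v ∈ A) ∧
    isingSum x S ^ 2 * 4 ^ m ≤ 4 * 4 ^ Fintype.card V * (1 + x) ^ k

namespace IsingBound

variable {x : ℝ} {G : SimpleGraph V} {A B : Set V} {m k : ℕ}

theorem single (x : ℝ) (G : SimpleGraph V) (v : V) : IsingBound x G {v} 1 0 := by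
  refine ⟨∅, by simp, ?_⟩
  rw [isingSum_empty, ← pow_mul, mul_comm _ 2, pow_mul]
  norm_num
  linarith

theorem mono (h : IsingBound x G A m k) (hAB : A ⊆ B) : IsingBound x G B m k := by
  obtain ⟨S, hS, hb⟩ := h
  exact ⟨S, fun e he => ⟨(hS e he).1, fun v hv => hAB ((hS e he).2 v hv)⟩, hb⟩

theorem isingSum_le (hx : 0 ≤ x) (hx1 : x ≤ 1) (h : IsingBound x G A (Fintype.card V) k)
    {S : Finset (Sym2 V)} (hS : ∀ e ∈ G.edgeSet, e ∈ S) : isingSum x S ^ 2 ≤ 4 * (1 + x) ^ k := by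
  obtain ⟨T, hT, hb⟩ := h
  have h1 : isingSum x S ^ 2 ≤ isingSum x T ^ 2 :=
    pow_le_pow_left₀ (isingSum_nonneg hx S)
      (isingSum_anti hx hx1 fun e he => hS e (hT e he).1) 2
  have h2 : isingSum x T ^ 2 ≤ 4 * (1 + x) ^ k := by
    have h4 : (0 : ℝ) < 4 ^ Fintype.card V := by positivity
    refine le_of_mul_le_mul_right ?_ h4
    linarith
  exact h1.trans h2

/-- Common bookkeeping for attaching j new vertices at total cost c. The bound is squared because a
cycle saves only half a power of 1 + x; k counts half powers. -/
theorem extend (hx : 0 ≤ x) {c : ℝ} {j l : ℕ} (hcl : c ^ 2 ≤ (1 + x) ^ l)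
    {S T : Finset (Sym2 V)} (hT : 2 ^ j * isingSum x T ≤ c * isingSum x S)
    (hb : isingSum x S ^ 2 * 4 ^ m ≤ 4 * 4 ^ Fintype.card V * (1 + x) ^ k) :
    isingSum x T ^ 2 * 4 ^ (m + j) ≤ 4 * 4 ^ Fintype.card V * (1 + x) ^ (k + l) := by
  have h0 := isingSum_nonneg hx T
  have h1 : (2 ^ j * isingSum x T) ^ 2 ≤ (c * isingSum x S) ^ 2 :=
    pow_le_pow_left₀ (by positivity) hT 2
  have h2 : (4 : ℝ) ^ j = (2 ^ j) ^ 2 := by rw [← pow_mul, mul_comm, pow_mul]; norm_num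
  calc isingSum x T ^ 2 * 4 ^ (m + j) = (2 ^ j * isingSum x T) ^ 2 * 4 ^ m := by
        rw [pow_add, h2]; ring
    _ ≤ (c * isingSum x S) ^ 2 * 4 ^ m := by gcongr
    _ = c ^ 2 * (isingSum x S ^ 2 * 4 ^ m) := by ring
    _ ≤ (1 + x) ^ l * (4 * 4 ^ Fintype.card V * (1 + x) ^ k) := by gcongr
    _ = _ := by rw [pow_add]; ring

theorem pendant (h : IsingBound x G A m k) (hx : 0 ≤ x) {u v : V} (hu : u ∈ A) (hv : v ∉ A)
    (huv : G.Adj u v) (hB : A ⊆ B) (hvB : v ∈ B) : IsingBound x G B (m + 1) (k + 2) := by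
  classical
  obtain ⟨S, hS, hb⟩ := h
  refine ⟨insert s(u, v) S, ?_, extend hx (c := 1 + x) le_rfl ?_ hb⟩
  · intro e he
    rcases Finset.mem_insert.mp he with rfl | he
    · refine ⟨huv, fun w hw => ?_⟩
      rcases Sym2.mem_iff.mp hw with rfl | rfl
      exacts [hB hu, hvB]
    · exact ⟨(hS e he).1, fun w hw => hB ((hS e he).2 w hw)⟩
  · rw [pow_one]
    exact (isingSum_insert_pendant x S huv.ne fun e he hve => hv ((hS e he).2 v hve)).le

/-- Two pendant vertices would cost four half powers; closing the cycle saves one, since (1 + 3x²)²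
≤ (1 + x)³ for x ≤ 1/2. The longer path saves one in the same way, by (1 + 6x² + x⁴)² ≤ (1 + x)⁵. -/
theorem path₂ (h : IsingBound x G A m k) (hx : 0 ≤ x) (hx2 : x ≤ 1 / 2) {u v₁ v₂ w : V}
    (hu : u ∈ A) (hw : w ∈ A) (hv₁ : v₁ ∉ A) (hv₂ : v₂ ∉ A) (h₁ : G.Adj u v₁) (h₂ : G.Adj v₁ v₂)
    (h₃ : G.Adj v₂ w) (hB : A ⊆ B) (hB₁ : v₁ ∈ B) (hB₂ : v₂ ∈ B) :
    IsingBound x G B (m + 2) (k + 3) := by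
  classical
  obtain ⟨S, hS, hb⟩ := h
  have hne : ∀ {y v}, y ∈ A → v ∉ A → y ≠ v := fun hy hv hyv => hv (hyv ▸ hy)
  have hnS : ∀ {v}, v ∉ A → ∀ e ∈ S, v ∉ e := fun hv e he hve => hv ((hS e he).2 _ hve)
  refine ⟨insert s(u, v₁) (insert s(v₁, v₂) (insert s(v₂, w) S)), ?_,
    extend hx (c := 1 + 3 * x ^ 2) ?_ ?_ hb⟩
  · intro e he
    simp only [Finset.mem_insert] at he
    rcases he with rfl | rfl | rfl | he
    · exact ⟨h₁, fun y hy => by rcases Sym2.mem_iff.mp hy with rfl | rfl; exacts [hB hu, hB₁]⟩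
    · exact ⟨h₂, fun y hy => by rcases Sym2.mem_iff.mp hy with rfl | rfl; exacts [hB₁, hB₂]⟩
    · exact ⟨h₃, fun y hy => by rcases Sym2.mem_iff.mp hy with rfl | rfl; exacts [hB₂, hB hw]⟩
    · exact ⟨(hS e he).1, fun w hw => hB ((hS e he).2 w hw)⟩
  · have e1 : x ^ 2 ≤ x * (1 / 2) := by nlinarith
    have e2 : x ^ 4 ≤ x * (1 / 2) ^ 3 := by
      have := pow_le_pow_left₀ hx hx2 3
      calc x ^ 4 = x * x ^ 3 := by ring
        _ ≤ _ := by gcongr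
    have e3 : 0 ≤ x ^ 3 := by positivity
    nlinarith
  · have := isingSum_insert_path₂ hx (by linarith) S h₂.ne (hne hu hv₁) (hne hu hv₂) (hne hw hv₁)
      (hne hw hv₂) (hnS hv₁) (hnS hv₂)
    norm_num
    exact this

theorem path₃ (h : IsingBound x G A m k) (hx : 0 ≤ x) (hx2 : x ≤ 1 / 2) {u v₁ v₂ v₃ w : V}
    (hu : u ∈ A) (hw : w ∈ A) (hv₁ : v₁ ∉ A) (hv₂ : v₂ ∉ A) (hv₃ : v₃ ∉ A) (h13 : v₁ ≠ v₃)
    (h₁ : G.Adj u v₁) (h₂ : G.Adj v₁ v₂) (h₃ : G.Adj v₂ v₃) (h₄ : G.Adj v₃ w)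
    (hB : A ⊆ B) (hB₁ : v₁ ∈ B) (hB₂ : v₂ ∈ B) (hB₃ : v₃ ∈ B) :
    IsingBound x G B (m + 3) (k + 5) := by
  classical
  obtain ⟨S, hS, hb⟩ := h
  have hne : ∀ {y v}, y ∈ A → v ∉ A → y ≠ v := fun hy hv hyv => hv (hyv ▸ hy)
  have hnS : ∀ {v}, v ∉ A → ∀ e ∈ S, v ∉ e := fun hv e he hve => hv ((hS e he).2 _ hve)
  refine ⟨insert s(u, v₁) (insert s(v₁, v₂) (insert s(v₂, v₃) (insert s(v₃, w) S))), ?_,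
    extend hx (c := 1 + 6 * x ^ 2 + x ^ 4) ?_ ?_ hb⟩
  · intro e he
    simp only [Finset.mem_insert] at he
    rcases he with rfl | rfl | rfl | rfl | he
    · exact ⟨h₁, fun y hy => by rcases Sym2.mem_iff.mp hy with rfl | rfl; exacts [hB hu, hB₁]⟩
    · exact ⟨h₂, fun y hy => by rcases Sym2.mem_iff.mp hy with rfl | rfl; exacts [hB₁, hB₂]⟩
    · exact ⟨h₃, fun y hy => by rcases Sym2.mem_iff.mp hy with rfl | rfl; exacts [hB₂, hB₃]⟩
    · exact ⟨h₄, fun y hy => by rcases Sym2.mem_iff.mp hy with rfl | rfl; exacts [hB₃, hB hw]⟩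
    · exact ⟨(hS e he).1, fun w hw => hB ((hS e he).2 w hw)⟩
  · have e0 : ∀ j : ℕ, x ^ (j + 1) ≤ x * (1 / 2) ^ j := fun j => by
      have := pow_le_pow_left₀ hx hx2 j
      calc x ^ (j + 1) = x * x ^ j := by ring
        _ ≤ _ := by gcongr
    have e2 := e0 1
    have e4 := e0 3
    have e6 := e0 5
    have e8 := e0 7
    have p2 : 0 ≤ x ^ 2 := by positivity
    have p3 : 0 ≤ x ^ 3 := by positivity
    have p4 : 0 ≤ x ^ 4 := by positivity
    have p5 : 0 ≤ x ^ 5 := by positivity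
    norm_num at e2 e4 e6 e8
    have hl : (1 + 6 * x ^ 2 + x ^ 4) ^ 2 =
        1 + 12 * x ^ 2 + 38 * x ^ 4 + 12 * x ^ 6 + x ^ 8 := by ring
    have hr : (1 + x) ^ 5 =
        1 + 5 * x + 10 * x ^ 2 + 10 * x ^ 3 + 5 * x ^ 4 + x ^ 5 := by ring
    have e4' : x ^ 4 ≤ x ^ 3 * (1 / 2) := by
      calc x ^ 4 = x ^ 3 * x := by ring
        _ ≤ _ := by gcongr
    rw [hl, hr]
    linarith
  · have := isingSum_insert_path₃ hx S h₂.ne h13 h₃.ne (hne hu hv₁) (hne hu hv₂)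
      (hne hu hv₃) (hne hw hv₁) (hne hw hv₂) (hne hw hv₃) (hnS hv₁) (hnS hv₂) (hnS hv₃)
    norm_num
    exact this

end IsingBound

end IsingBounds

/-! ### Random tensor trains -/

section TensorTrain

open RTN

/-- Each successive edge is pendant when it is added. The vertices beyond the first k + 1 stay free,
whence the factor 2^n. -/
theorem exists_isingSum_path (x : ℝ) {n k : ℕ} (hk : k < n) : ∃ S : Finset (Sym2 (Fin n)),
    (∀ e, e ∈ S ↔ ∃ (i : ℕ) (h : i + 1 < n), i < k ∧ e = s(⟨i, by lia⟩, ⟨i + 1, h⟩)) ∧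
      2 ^ k * isingSum x S = (1 + x) ^ k * 2 ^ n := by
  classical
  induction k with
  | zero => exact ⟨∅, by simp, by simp [isingSum_empty]⟩
  | succ k ih =>
    obtain ⟨S, hS, hval⟩ := ih (by lia)
    refine ⟨insert s(⟨k, by lia⟩, ⟨k + 1, hk⟩) S, fun e => ?_, ?_⟩
    · rw [Finset.mem_insert, hS]
      constructor
      · rintro (rfl | ⟨i, h, hik, rfl⟩)
        · exact ⟨k, hk, by lia, rfl⟩
        · exact ⟨i, h, by lia, rfl⟩
      · rintro ⟨i, h, hik, rfl⟩
        rcases Nat.lt_succ_iff_lt_or_eq.mp hik with hik | rfl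
        · exact Or.inr ⟨i, h, hik, rfl⟩
        · exact Or.inl rfl
    · have h := isingSum_insert_pendant x S (u := (⟨k, by lia⟩ : Fin n)) (v := ⟨k + 1, hk⟩)
        (by simp [Fin.ext_iff]) fun e he hmem => by
          obtain ⟨i, hi, hik, rfl⟩ := (hS e).mp he
          simp only [Sym2.mem_iff, Fin.mk.injEq] at hmem
          lia
      rw [pow_succ, mul_assoc, h, mul_left_comm, hval]
      ring

/-- An edge costs at most a factor x, so allowing one edge off the path treats open and closed
chains together at the price of a constant. -/
theorem le_isingSum_of_path {x : ℝ} (hx : 0 ≤ x) (hx1 : x ≤ 1) {n : ℕ} (hn : 0 < n)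
    {e₀ : Sym2 (Fin n)} {S : Finset (Sym2 (Fin n))}
    (hS : ∀ e ∈ S, e ∈ (SimpleGraph.pathGraph n).edgeSet ∨ e = e₀) :
    2 * x * (1 + x) ^ (n - 1) ≤ isingSum x S := by
  classical
  obtain ⟨P, hP, hval⟩ := exists_isingSum_path x (n := n) (k := n - 1) (by lia)
  have hsub : S ⊆ insert e₀ P := by
    intro e he
    rw [Finset.mem_insert, hP]
    rcases hS e he with h | h
    · right
      induction e with
      | _ u v =>
        rw [SimpleGraph.mem_edgeSet, SimpleGraph.pathGraph_adj] at h
        rcases h with h | h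
        · exact ⟨u.val, by lia, by lia, by simp [h]⟩
        · refine ⟨v.val, by lia, by lia, ?_⟩
          rw [Sym2.eq_swap]
          simp [h]
    · exact Or.inl h
  have h1 : isingSum x P = 2 * (1 + x) ^ (n - 1) := by
    have h2 : (2 : ℝ) ^ n = 2 * 2 ^ (n - 1) := by rw [← pow_succ']; congr 1; lia
    have h3 : (2 : ℝ) ^ (n - 1) ≠ 0 := by positivity
    apply mul_left_cancel₀ h3
    rw [hval, h2]; ring
  calc 2 * x * (1 + x) ^ (n - 1) = x * isingSum x P := by rw [h1]; ring
    _ ≤ isingSum x (insert e₀ P) := mul_isingSum_le_insert hx hx1 e₀ P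
    _ ≤ isingSum x S := isingSum_anti hx hx1 hsub

theorem tensorDim_eq {V : Type*} [Fintype V] (G : SimpleGraph V) (ext : V → ℕ) (a b d : ℕ) (v : V) :
    tensorDim G ext a b d v = a ^ ext v * (d * b ^ (G.neighborSet v).ncard) := by
  classical
  simp [tensorDim, Set.ncard_eq_toFinset_card']

theorem div_add_one_mono {s t : ℝ} (hs : 0 ≤ s) (hst : s ≤ t) : s / (s + 1) ≤ t / (t + 1) := by
  rw [div_le_div_iff₀ (by linarith) (by linarith)]
  nlinarith

/-- An inner tensor has at least two neighbours and a ≥ 2, hence dimension at least 2b². The two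
ends are estimated only by D/(D+1) ≥ 1/2, which gives the 1/4. -/
theorem le_prod_tensorDim_of_path {n a b d : ℕ} (ha : 2 ≤ a) (hb : 1 ≤ b) (hd : 1 ≤ d)
    (G : SimpleGraph (Fin n)) (hG : SimpleGraph.pathGraph n ≤ G) :
    (1 / 4 : ℝ) * (2 * (b : ℝ) ^ 2 / (2 * (b : ℝ) ^ 2 + 1)) ^ n ≤
      ∏ v, ((tensorDim G (fun _ => 1) a b d v : ℝ) / (tensorDim G (fun _ => 1) a b d v + 1)) := by
  set ρ : ℝ := 2 * (b : ℝ) ^ 2 / (2 * (b : ℝ) ^ 2 + 1) with hρ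
  have hρ0 : 0 ≤ ρ := by positivity
  have hρ1 : ρ ≤ 1 := by
    rw [hρ, div_le_one (by positivity)]; linarith
  have hpos : ∀ v, 1 ≤ tensorDim G (fun _ => 1) a b d v := by
    intro v
    rw [tensorDim_eq]
    exact Nat.succ_le_of_lt (by positivity)
  have hint : ∀ v : Fin n, v.val ≠ 0 → v.val + 1 ≠ n →
      2 * b ^ 2 ≤ tensorDim G (fun _ => 1) a b d v := by
    intro v h0 h1
    have hdeg : 2 ≤ (G.neighborSet v).ncard := by
      have hne : (⟨v.val - 1, by lia⟩ : Fin n) ≠ ⟨v.val + 1, by lia⟩ := by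
        simp only [ne_eq, Fin.mk.injEq]; lia
      rw [← Set.ncard_pair hne]
      refine Set.ncard_le_ncard ?_ (Set.toFinite _)
      rintro w (rfl | rfl)
      · exact hG (SimpleGraph.pathGraph_adj.mpr (Or.inr (by simp; lia)))
      · exact hG (SimpleGraph.pathGraph_adj.mpr (Or.inl (by simp)))
    rw [tensorDim_eq, pow_one]
    calc 2 * b ^ 2 ≤ a * b ^ (G.neighborSet v).ncard :=
          Nat.mul_le_mul ha (Nat.pow_le_pow_right hb hdeg)
      _ ≤ _ := Nat.mul_le_mul_left _ (Nat.le_mul_of_pos_left _ hd)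
  have hstep : ∀ v : Fin n, ρ * ((if v.val = 0 then 1 / 2 else 1) *
      (if v.val + 1 = n then 1 / 2 else 1)) ≤
      (tensorDim G (fun _ => 1) a b d v : ℝ) / (tensorDim G (fun _ => 1) a b d v + 1) := by
    intro v
    have hhalf : (1 / 2 : ℝ) ≤
        (tensorDim G (fun _ => 1) a b d v : ℝ) / (tensorDim G (fun _ => 1) a b d v + 1) := by
      have := div_add_one_mono (s := 1) (t := tensorDim G (fun _ => 1) a b d v) (by norm_num)
        (by exact_mod_cast hpos v)
      norm_num at this ⊢
      exact this
    by_cases h0 : v.val = 0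
    · refine le_trans ?_ hhalf
      split_ifs <;> linarith
    by_cases h1 : v.val + 1 = n
    · refine le_trans ?_ hhalf
      split_ifs; linarith
    rw [if_neg h0, if_neg h1, mul_one, mul_one]
    exact div_add_one_mono (by positivity) (by exact_mod_cast hint v h0 h1)
  refine le_trans ?_ (Finset.prod_le_prod (fun v _ => by split_ifs <;> positivity)
    fun v _ => hstep v)
  rw [Finset.prod_mul_distrib, Finset.prod_const, Finset.card_univ, Fintype.card_fin,
    Finset.prod_mul_distrib, mul_comm]
  refine mul_le_mul_of_nonneg_left ?_ (by positivity)
  have hone : ∀ (p : Fin n → Prop) [DecidablePred p], (∀ i j, p i → p j → i = j) →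
      (1 / 2 : ℝ) ≤ ∏ v, if p v then 1 / 2 else 1 := by
    intro p _ hp
    rw [← Finset.prod_filter, Finset.prod_const]
    have hc : (Finset.univ.filter p).card ≤ 1 := Finset.card_le_one.mpr fun i hi j hj =>
      hp i j (Finset.mem_filter.mp hi).2 (Finset.mem_filter.mp hj).2
    calc (1 / 2 : ℝ) = (1 / 2) ^ 1 := by norm_num
      _ ≤ _ := pow_le_pow_of_le_one (by norm_num) (by norm_num) hc
  have e1 := hone (fun v => v.val = 0) fun i j hi hj => Fin.ext (by lia)
  have e2 := hone (fun v => v.val + 1 = n) fun i j hi hj => Fin.ext (by lia)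
  calc (1 / 4 : ℝ) = (1 / 2) * (1 / 2) := by norm_num
    _ ≤ _ := mul_le_mul e1 e2 (by norm_num) (by linarith)

theorem le_invEffDim_tensorTrain {n a b d : ℕ} (hn : 0 < n) (ha : 2 ≤ a) (hb : 1 ≤ b) (hd : 1 ≤ d)
    (G : SimpleGraph (Fin n)) (hG : SimpleGraph.pathGraph n ≤ G) (e₀ : Sym2 (Fin n))
    (he : ∀ e ∈ G.edgeSet, e ∈ (SimpleGraph.pathGraph n).edgeSet ∨ e = e₀)
    (T : RTN G (fun _ => 1) a b d) (hT : T.Unentangled) :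
    ((a : ℝ) ^ n)⁻¹ * ((1 / 4 : ℝ) * (2 * (b : ℝ) ^ 2 / (2 * (b : ℝ) ^ 2 + 1)) ^ n) *
      (2 * (1 / b) * (1 + 1 / b) ^ (n - 1)) ≤ T.invEffDim := by
  rw [T.invEffDim_eq (by lia) (by lia) (by lia) hT]
  have hcard : Fintype.card (PhysSite fun _ : Fin n => 1) = n := by simp
  have hb' : (1 : ℝ) ≤ b := by exact_mod_cast hb
  have hx1 : 1 / (b : ℝ) ≤ 1 := by rw [div_le_one (by linarith)]; exact hb'
  rw [hcard]
  refine mul_le_mul (mul_le_mul_of_nonneg_left (le_prod_tensorDim_of_path ha hb hd G hG)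
    (by positivity)) ?_ (by positivity) ?_
  · refine le_isingSum_of_path (by positivity) hx1 hn (e₀ := e₀) fun e h => he e ?_
    simpa using h
  · refine mul_nonneg (by positivity) (Finset.prod_nonneg fun v _ => by positivity)

theorem cycleGraph_edgeSet {n : ℕ} (hn : 0 < n) (e : Sym2 (Fin n))
    (he : e ∈ (SimpleGraph.cycleGraph n).edgeSet) :
    e ∈ (SimpleGraph.pathGraph n).edgeSet ∨ e = s(⟨0, hn⟩, ⟨n - 1, by lia⟩) := by
  induction e with
  | _ u v =>
    rw [SimpleGraph.mem_edgeSet] at he ⊢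
    have hne := he.ne
    rw [SimpleGraph.cycleGraph_adj'] at he
    rw [SimpleGraph.pathGraph_adj, Sym2.eq_iff]
    simp only [Fin.ext_iff, Fin.sub_def] at he hne ⊢
    have hu := u.2
    have hv := v.2
    have hmod : ∀ c d : ℕ, c < n → d < n → (n - c + d) % n = 1 →
        c + 1 = d ∨ (c = n - 1 ∧ d = 0) := by
      intro c d hc hd h
      rcases Nat.lt_or_ge (n - c + d) n with h1 | h1
      · rw [Nat.mod_eq_of_lt h1] at h; lia
      · rw [Nat.mod_eq_sub_mod h1, Nat.mod_eq_of_lt (by lia)] at h; lia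
    rcases he with h | h
    · have := hmod _ _ hv hu h; lia
    · have := hmod _ _ hu hv h; lia

end TensorTrain

/-! ### Counting tiles and boundary sites -/

section Inflate

/-- The sides of a boundary at whose end two tiles meet. -/
def doubleSides (bs : List (ℕ × ℕ)) : ℕ := bs.countP fun s => s.2 = 2

/-- Each boundary side is glued to exactly one new tile, also when neighbouring sides share a tile.
-/
theorem sum_length_inflate (q : ℕ) (bs : List (ℕ × ℕ)) :
    ((inflate q bs).map List.length).sum = bs.length := by
  induction bs with
  | nil => simp [inflate]
  | cons s bs ih =>
    obtain ⟨i, t⟩ := s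
    rw [inflate]
    split_ifs
    · simp [ih]; lia
    · split
      · next h => rw [h] at ih; simp only [List.map_nil, List.sum_nil] at ih; simp [← ih]
      · next u us h => rw [h] at ih; simp at ih ⊢; lia

theorem exists_of_mem_inflate {q : ℕ} {bs : List (ℕ × ℕ)} {u : List ℕ} (hu : u ∈ inflate q bs)
    {i : ℕ} (hi : i ∈ u) : ∃ s ∈ bs, s.1 = i := by
  induction bs generalizing u with
  | nil => simp [inflate] at hu
  | cons s bs ih =>
    obtain ⟨i', t⟩ := s
    rw [inflate] at hu
    have lift : (∃ s ∈ bs, s.1 = i) → ∃ s ∈ (i', t) :: bs, s.1 = i := fun ⟨s, hs, h⟩ =>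
      ⟨s, List.mem_cons_of_mem _ hs, h⟩
    split_ifs at hu
    · rw [List.mem_cons, List.mem_append] at hu
      rcases hu with rfl | hu | hu
      · exact ⟨(i', t), by simp, (List.mem_singleton.mp hi).symm⟩
      · rw [List.eq_of_mem_replicate hu] at hi; simp at hi
      · exact lift (ih hu hi)
    · split at hu
      · simp only [List.mem_singleton] at hu
        subst hu
        exact ⟨(i', t), by simp, (List.mem_singleton.mp hi).symm⟩
      · next u' us h =>
        rcases List.mem_cons.mp hu with rfl | hu
        · rcases List.mem_cons.mp hi with rfl | hi
          · exact ⟨(i, t), by simp, rfl⟩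
          · exact lift (ih (by rw [h]; simp) hi)
        · exact lift (ih (by rw [h]; simp [hu]) hi)

theorem exists_inflate_eq_cons (q : ℕ) {bs : List (ℕ × ℕ)} (h : bs ≠ []) :
    ∃ i u us, inflate q bs = (i :: u) :: us := by
  cases bs with
  | nil => exact absurd rfl h
  | cons s bs =>
    obtain ⟨i, t⟩ := s
    rw [inflate]
    split_ifs
    · exact ⟨i, [], _, rfl⟩
    · split
      · exact ⟨i, [], _, rfl⟩
      · exact ⟨i, _, _, rfl⟩

/-- With t ≤ 2 ≤ q - 2 no two sides share a tile, and a side accounts for q - 1 - t new tiles: q -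
2, less one if it is double. -/
theorem inflate_of_four_le {q : ℕ} (hq : 4 ≤ q) {bs : List (ℕ × ℕ)}
    (hbs : ∀ s ∈ bs, s.2 = 1 ∨ s.2 = 2) :
    (inflate q bs).length + doubleSides bs = (q - 2) * bs.length ∧
      ∀ u ∈ inflate q bs, u.length ≤ 1 := by
  induction bs with
  | nil => simp [inflate, doubleSides]
  | cons s bs ih =>
    obtain ⟨i, t⟩ := s
    obtain ⟨ih1, ih2⟩ := ih fun s hs => hbs s (List.mem_cons_of_mem _ hs)
    have ht : t = 1 ∨ t = 2 := hbs (i, t) List.mem_cons_self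
    rw [inflate, if_pos (by lia)]
    constructor
    · rw [doubleSides, List.countP_cons, ← doubleSides]
      simp only [List.length_cons, List.length_append, List.length_replicate, mul_add, mul_one]
      rcases ht with rfl | rfl <;> simp <;> lia
    · intro u hu
      rw [List.mem_cons, List.mem_append] at hu
      rcases hu with rfl | hu | hu
      · simp
      · rw [List.eq_of_mem_replicate hu]; simp
      · exact ih2 u hu

theorem inflate_three_replicate (j k : ℕ) (bs : List (ℕ × ℕ)) :
    inflate 3 (List.replicate k (j, 1) ++ bs) = List.replicate k [j] ++ inflate 3 bs := by
  induction k with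
  | zero => simp
  | succ k ih => simp [List.replicate_succ, inflate, ih]

theorem inflate_three_block (i j k : ℕ) (bs : List (ℕ × ℕ)) :
    inflate 3 ((i, 2) :: (List.replicate (k + 1) (j, 1) ++ bs)) =
      [i, j] :: (List.replicate k [j] ++ inflate 3 bs) := by
  rw [inflate, if_neg (by lia), inflate_three_replicate, List.replicate_succ]
  rfl

/-- For q = 3 a double side shares its new tile with the next side, which costs one tile. The `+ 1`
guarantees that the next side is not double, so no tile is glued to three sides. -/
theorem inflate_three_flatMap {α : Type*} (l : List α) (i j k : α → ℕ) :
    (inflate 3 (l.flatMap fun s => (i s, 2) :: List.replicate (k s + 1) (j s, 1))).length +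
        doubleSides (l.flatMap fun s => (i s, 2) :: List.replicate (k s + 1) (j s, 1)) =
      (l.flatMap fun s => (i s, 2) :: List.replicate (k s + 1) (j s, 1)).length ∧
    ∀ u ∈ inflate 3 (l.flatMap fun s => (i s, 2) :: List.replicate (k s + 1) (j s, 1)),
      u.length ≤ 2 := by
  induction l with
  | nil => simp [inflate, doubleSides]
  | cons s l ih =>
    obtain ⟨ih1, ih2⟩ := ih
    rw [List.flatMap_cons, List.cons_append, inflate_three_block]
    constructor
    · have h : List.countP (fun s : ℕ × ℕ => decide (s.2 = 2))
          (List.replicate (k s + 1) (j s, 1)) = 0 := by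
        simp [List.countP_replicate]
      rw [doubleSides, List.countP_cons, List.countP_append, h]
      rw [doubleSides] at ih1
      simp only [List.length_cons, List.length_append, List.length_replicate, decide_true, if_true]
      lia
    · intro u hu
      rw [List.mem_cons, List.mem_append] at hu
      rcases hu with rfl | hu | hu
      · simp
      · rw [List.eq_of_mem_replicate hu]; simp
      · exact ih2 u hu

end Inflate

/-! ### Sides of the boundary of a patch. -/

section Boundary

variable {p : ℕ}

theorem patchBoundary_succ_eq_of_length {ts : List (List ℕ)} (h : ∀ u ∈ ts, u.length + 4 ≤ p)
    (ℓ : ℕ) : patchBoundary p (ℓ + 1) ts = (List.finRange ts.length).flatMap fun j =>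
      ((j.val + ts.length - 1) % ts.length, 2) ::
        List.replicate (p - 4 - (ts.get j).length + 1) (j.val, 1) := by
  rw [patchBoundary]
  congr 1
  funext j
  have := h _ (List.get_mem ts j)
  congr 2
  lia

theorem sum_finRange_get {α : Type*} (l : List α) (f : α → ℕ) :
    ((List.finRange l.length).map fun j => f (l.get j)).sum = (l.map f).sum := by
  conv_rhs => rw [← List.map_get_finRange l, List.map_map]
  rfl

theorem length_patchBoundary_succ {ts : List (List ℕ)} (h : ∀ u ∈ ts, u.length + 3 ≤ p) (ℓ : ℕ) :
    (patchBoundary p (ℓ + 1) ts).length + (ts.map List.length).sum = (p - 2) * ts.length := by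
  have h1 : (patchBoundary p (ℓ + 1) ts).length = (ts.map fun u => 1 + (p - 3 - u.length)).sum := by
    rw [patchBoundary, List.length_flatMap, 
      ← sum_finRange_get ts fun u => 1 + (p - 3 - u.length)]
    congr 2
    funext j
    simp [add_comm]
  rw [h1]
  clear h1
  induction ts with
  | nil => simp
  | cons u ts ih =>
    have h2 := h u List.mem_cons_self
    have h3 := ih fun u hu => h u (List.mem_cons_of_mem _ hu)
    simp only [List.map_cons, List.sum_cons, List.length_cons, mul_add, mul_one]
    lia

theorem doubleSides_patchBoundary_succ (ts : List (List ℕ)) (ℓ : ℕ) :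
    doubleSides (patchBoundary p (ℓ + 1) ts) = ts.length := by
  rw [patchBoundary, doubleSides, List.countP_flatMap]
  have h : ∀ j : Fin ts.length, (List.countP (fun s : ℕ × ℕ => decide (s.2 = 2)) ∘ fun j =>
      ((j.val + ts.length - 1) % ts.length, 2) ::
        List.replicate (p - 3 - (ts.get j).length) (j.val, 1)) j = 1 := by
    intro j
    simp [List.countP_replicate]
  rw [List.map_congr_left fun j _ => h j]
  simp

theorem mem_patchBoundary {ts : List (List ℕ)} (hts : ts ≠ []) {ℓ : ℕ} {s : ℕ × ℕ}
    (hs : s ∈ patchBoundary p ℓ ts) : s.1 < ts.length ∧ (s.2 = 1 ∨ s.2 = 2) := by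
  have hpos := List.length_pos_iff.mpr hts
  cases ℓ with
  | zero =>
    rw [patchBoundary] at hs
    rw [List.eq_of_mem_replicate hs]
    exact ⟨hpos, Or.inl rfl⟩
  | succ ℓ =>
    rw [patchBoundary, List.mem_flatMap] at hs
    obtain ⟨j, -, hj⟩ := hs
    rcases List.mem_cons.mp hj with rfl | hj
    · exact ⟨Nat.mod_lt _ hpos, Or.inr rfl⟩
    · rw [List.eq_of_mem_replicate hj]
      exact ⟨j.2, Or.inl rfl⟩

end Boundary

/-! ### Recursions for layer and boundary sizes. -/

section Layers

variable {p q : ℕ}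

/-- The number of tiles of a layer. -/
def layerSize (p q ℓ : ℕ) : ℕ := (tilingLayer p q ℓ).length

/-- The number of sides of the boundary of a patch. -/
def boundarySize (p q ℓ : ℕ) : ℕ := (patchBoundary p ℓ (tilingLayer p q ℓ)).length

theorem boundarySize_zero : boundarySize p q 0 = p := by
  simp [boundarySize, patchBoundary]

theorem layerSize_zero : layerSize p q 0 = 1 := by
  simp [layerSize, tilingLayer]

/-- The pairs `p, q` of hyperbolic tilings other than by triangles. -/
def IsHyperbolic (p q : ℕ) : Prop := (4 ≤ p ∧ 4 ≤ q ∧ 9 ≤ p + q) ∨ (7 ≤ p ∧ q = 3)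

/-- The facts are proved jointly because the count of the next layer depends on the shape of the
current one. -/
theorem tilingLayer_spec (h : IsHyperbolic p q) (ℓ : ℕ) :
    tilingLayer p q ℓ ≠ [] ∧ patchBoundary p ℓ (tilingLayer p q ℓ) ≠ [] ∧
      (∀ u ∈ tilingLayer p q (ℓ + 1), u.length + 3 ≤ p) ∧
      layerSize p q (ℓ + 1) + doubleSides (patchBoundary p ℓ (tilingLayer p q ℓ)) =
        (q - 2) * boundarySize p q ℓ := by
  have hp : 4 ≤ p := by unfold IsHyperbolic at h; lia
  -- For q = 3 the induction also carries the bound of two inner neighbours; with p ≥ 7 it keeps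
  -- double sides from being consecutive.
  have key : ∀ ℓ, tilingLayer p q ℓ ≠ [] → patchBoundary p ℓ (tilingLayer p q ℓ) ≠ [] →
      (∀ ℓ', ℓ = ℓ' + 1 → ∀ u ∈ tilingLayer p q ℓ, u.length + 3 ≤ p ∧ (q = 3 → u.length ≤ 2)) →
      (∀ u ∈ tilingLayer p q (ℓ + 1), u.length + 3 ≤ p ∧ (q = 3 → u.length ≤ 2)) ∧
      layerSize p q (ℓ + 1) + doubleSides (patchBoundary p ℓ (tilingLayer p q ℓ)) =
        (q - 2) * boundarySize p q ℓ := by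
    intro ℓ h1 h2 h3
    rw [layerSize, boundarySize, tilingLayer]
    rcases h with ⟨_, hq, _⟩ | ⟨hp7, rfl⟩
    · obtain ⟨e1, e2⟩ := inflate_of_four_le hq fun s hs => (mem_patchBoundary h1 hs).2
      exact ⟨fun u hu => by have := e2 u hu; lia, e1⟩
    · cases ℓ with
      | zero =>
        have e := inflate_three_replicate 0 p []
        rw [List.append_nil] at e
        rw [patchBoundary, e]
        simp only [inflate, List.append_nil]
        refine ⟨fun u hu => ?_, ?_⟩
        · rw [List.eq_of_mem_replicate hu]; simp; lia
        · simp [doubleSides, List.countP_replicate]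
      | succ ℓ =>
        rw [patchBoundary_succ_eq_of_length
          (fun u hu => by have := (h3 ℓ rfl u hu).2 rfl; lia)]
        obtain ⟨e1, e2⟩ := inflate_three_flatMap (List.finRange (tilingLayer p 3 (ℓ + 1)).length)
          (fun j => (j.val + (tilingLayer p 3 (ℓ + 1)).length - 1) %
            (tilingLayer p 3 (ℓ + 1)).length) (fun j => j.val)
          (fun j => p - 4 - ((tilingLayer p 3 (ℓ + 1)).get j).length)
        refine ⟨fun u hu => ?_, ?_⟩
        · have := e2 u hu; lia
        · rw [e1]; simp
  have main : ∀ ℓ, tilingLayer p q ℓ ≠ [] ∧ patchBoundary p ℓ (tilingLayer p q ℓ) ≠ [] ∧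
      (∀ ℓ', ℓ = ℓ' + 1 → ∀ u ∈ tilingLayer p q ℓ, u.length + 3 ≤ p ∧ (q = 3 → u.length ≤ 2)) := by
    intro ℓ
    induction ℓ with
    | zero =>
      refine ⟨by simp [tilingLayer], ?_, fun ℓ' h => by lia⟩
      rw [patchBoundary, ne_eq, List.replicate_eq_nil_iff]
      lia
    | succ ℓ ih =>
      obtain ⟨h1, h2, h3⟩ := ih
      obtain ⟨k1, k2⟩ := key ℓ h1 h2 h3
      have hne : tilingLayer p q (ℓ + 1) ≠ [] := by
        obtain ⟨i, u, us, e⟩ := exists_inflate_eq_cons q h2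
        rw [tilingLayer, e]; simp
      refine ⟨hne, ?_, fun _ _ => k1⟩
      have := doubleSides_patchBoundary_succ (p := p) (tilingLayer p q (ℓ + 1)) ℓ
      intro h0
      rw [h0] at this
      exact hne (List.length_eq_zero_iff.mp this.symm)
  obtain ⟨h1, h2, h3⟩ := main ℓ
  obtain ⟨k1, k2⟩ := key ℓ h1 h2 h3
  exact ⟨h1, h2, fun u hu => (k1 u hu).1, k2⟩

theorem layerSize_one (h : IsHyperbolic p q) : layerSize p q 1 = (q - 2) * p := by
  have := (tilingLayer_spec h 0).2.2.2
  rw [boundarySize_zero] at this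
  rw [← this]
  simp [patchBoundary, doubleSides, List.countP_replicate]

/-- Each tile of a layer beyond the central one accounts for exactly one double side. -/
theorem layerSize_add (h : IsHyperbolic p q) (ℓ : ℕ) :
    layerSize p q (ℓ + 2) + layerSize p q (ℓ + 1) = (q - 2) * boundarySize p q (ℓ + 1) := by
  rw [← (tilingLayer_spec h (ℓ + 1)).2.2.2, doubleSides_patchBoundary_succ]
  rfl

/-- Apart from the two sides towards its cyclic neighbours, a new tile has p - 2 sides; these are
either new boundary or glued to a side of the old one. -/
theorem boundarySize_add (h : IsHyperbolic p q) (ℓ : ℕ) :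
    boundarySize p q (ℓ + 1) + boundarySize p q ℓ = (p - 2) * layerSize p q (ℓ + 1) := by
  have h1 := length_patchBoundary_succ (tilingLayer_spec h ℓ).2.2.1 ℓ
  have h2 := sum_length_inflate q (patchBoundary p ℓ (tilingLayer p q ℓ))
  rw [← tilingLayer] at h2
  rw [h2] at h1
  exact h1

theorem sum_countP_eq_length {m : ℕ} {l : List (ℕ × ℕ)} (h : ∀ s ∈ l, s.1 < m) :
    ∑ j : Fin m, l.countP (fun s => s.1 = j.val) = l.length := by
  induction l with
  | nil => simp
  | cons s l ih =>
    have hs := h s List.mem_cons_self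
    simp only [List.countP_cons, Finset.sum_add_distrib, List.length_cons]
    rw [ih fun s hs => h s (List.mem_cons_of_mem _ hs)]
    congr 1
    rw [Finset.sum_eq_single ⟨s.1, hs⟩]
    · simp
    · intro j _ hj
      simp only [decide_eq_true_eq, ite_eq_right_iff]
      intro e
      exact absurd (Fin.ext e.symm) hj
    · simp

theorem patchSites_eq (h : IsHyperbolic p q) (L : ℕ) : patchSites p q L = boundarySize p q L := by
  rw [patchSites, Fintype.card_sigma, Fintype.sum_sigma, Finset.sum_eq_single (Fin.last L)]
  · simp only [patchExt, Fintype.card_fin, Fin.val_last, if_true]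
    exact sum_countP_eq_length fun s hs => (mem_patchBoundary (tilingLayer_spec h L).1 hs).1
  · intro ℓ _ hℓ
    have : ℓ.val ≠ L := fun e => hℓ (Fin.ext e)
    simp [patchExt, this]
  · simp

/-- The number of tiles in the layers `1, …, ℓ`. -/
def innerTiles (p q ℓ : ℕ) : ℕ := ∑ i ∈ Finset.range ℓ, layerSize p q (i + 1)

theorem card_patchTile (L : ℕ) : Fintype.card (PatchTile p q L) = 1 + innerTiles p q L := by
  rw [Fintype.card_sigma, Fin.sum_univ_succ]
  simp only [Fintype.card_fin]
  congr 1
  exact Fin.sum_univ_eq_sum_range (fun i => layerSize p q (i + 1)) L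

/-- Subtraction-free form of (PQ - 4)S = Qn - 2m - Q(P + 2), for S inner tiles, n sides and last
layer m. Hyperbolicity is PQ > 4, so bounds on m/n turn into bounds on S/n. -/
theorem innerTiles_eq (P Q : ℕ) (h : IsHyperbolic (P + 2) (Q + 2)) (L : ℕ) :
    P * Q * innerTiles (P + 2) (Q + 2) (L + 1) + 2 * layerSize (P + 2) (Q + 2) (L + 1) +
      Q * (P + 2) =
    Q * boundarySize (P + 2) (Q + 2) (L + 1) + 4 * innerTiles (P + 2) (Q + 2) (L + 1) := by
  have h0 := boundarySize_zero (p := P + 2) (q := Q + 2)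
  have hm1 := layerSize_one h
  have hm := layerSize_add h
  have hn := boundarySize_add h
  simp only [Nat.add_sub_cancel] at hm1 hm hn
  induction L with
  | zero =>
    have hn0 := hn 0
    rw [zero_add] at hn0 ⊢
    rw [innerTiles, Finset.sum_range_one, zero_add]
    nlinarith
  | succ L ih =>
    rw [innerTiles, Finset.sum_range_succ, ← innerTiles]
    have hm' := hm L
    have hn' := hn (L + 1)
    nlinarith

end Layers

/-! ### The Ising sum of a patch -/

section PatchIsing

variable {p q L : ℕ}

/-- The tile in position `j` of the layer `ℓ`. -/
def patchTile {ℓ j : ℕ} (hℓ : ℓ ≤ L) (hj : j < layerSize p q ℓ) : PatchTile p q L :=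
  ⟨⟨ℓ, Nat.lt_succ_of_le hℓ⟩, ⟨j, hj⟩⟩

/-- The first tiles of a patch: those in the layers before `ℓ`, and the first `j` of the layer
`ℓ`. -/
def firstTiles (p q L ℓ j : ℕ) : Set (PatchTile p q L) :=
  {s | s.1.val < ℓ ∨ (s.1.val = ℓ ∧ s.2.val < j)}

theorem patchTile_mem_firstTiles {ℓ j ℓ' j' : ℕ} (hℓ : ℓ ≤ L) (hj : j < layerSize p q ℓ) :
    patchTile hℓ hj ∈ firstTiles p q L ℓ' j' ↔ ℓ < ℓ' ∨ (ℓ = ℓ' ∧ j < j') := Iff.rfl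

theorem firstTiles_mono {ℓ j j' : ℕ} (h : j ≤ j') : firstTiles p q L ℓ j ⊆ firstTiles p q L ℓ j' :=
  fun _ hs => hs.imp id fun hs => ⟨hs.1, hs.2.trans_le h⟩

theorem firstTiles_layerSize (ℓ j : ℕ) : firstTiles p q L ℓ j ⊆ firstTiles p q L (ℓ + 1) 0 :=
  fun _ hs => Or.inl (by rcases hs with hs | hs <;> lia)

theorem adj_patchTile_succ {ℓ j : ℕ} (hℓ : ℓ ≤ L) (hj : j + 1 < layerSize p q ℓ) :
    (patchGraph p q L).Adj (patchTile hℓ (Nat.lt_of_succ_lt hj)) (patchTile hℓ hj) := by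
  rw [patchGraph, SimpleGraph.fromRel_adj]
  refine ⟨fun h => ?_, Or.inl (Or.inl ⟨rfl, ?_⟩)⟩
  · have h2 := (Sigma.mk.inj_iff.mp h).2
    have := Fin.mk.inj_iff.mp (eq_of_heq h2)
    lia
  · exact (Nat.mod_eq_of_lt hj).symm

theorem adj_patchTile_glued {ℓ i j : ℕ} (hℓ : ℓ + 1 ≤ L) (hi : i < layerSize p q ℓ)
    (hj : j < layerSize p q (ℓ + 1)) (h : i ∈ (tilingLayer p q (ℓ + 1))[j]'hj) :
    (patchGraph p q L).Adj (patchTile (Nat.le_of_succ_le hℓ) hi) (patchTile hℓ hj) := by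
  rw [patchGraph, SimpleGraph.fromRel_adj]
  refine ⟨fun e => ?_, Or.inl (Or.inr ⟨rfl, h⟩)⟩
  have := Fin.mk.inj_iff.mp (Sigma.mk.inj_iff.mp e).1
  lia

theorem IsingBound.pendants {x : ℝ} (hx : 0 ≤ x) {ℓ j : ℕ} (hℓ : ℓ ≤ L) (hj : 1 ≤ j) (g : ℕ)
    (hg : j + g ≤ layerSize p q ℓ) {m k : ℕ}
    (h : IsingBound x (patchGraph p q L) (firstTiles p q L ℓ j) m k) :
    IsingBound x (patchGraph p q L) (firstTiles p q L ℓ (j + g)) (m + g) (k + 2 * g) := by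
  induction g with
  | zero => exact h
  | succ g ih =>
    have ih := ih (by lia)
    have hadj := adj_patchTile_succ (p := p) (q := q) (j := j + g - 1) hℓ (by lia)
    refine ih.pendant hx ?_ ?_ hadj (firstTiles_mono (by lia)) ?_ <;>
      rw [patchTile_mem_firstTiles] <;> lia

theorem exists_glued (h : IsHyperbolic p q) (ℓ : ℕ) : ∃ (i : ℕ) (_ : i < layerSize p q ℓ)
    (hj : 0 < layerSize p q (ℓ + 1)), i ∈ (tilingLayer p q (ℓ + 1))[0]'hj := by
  obtain ⟨h1, h2, -, -⟩ := tilingLayer_spec h ℓ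
  obtain ⟨i, u, us, e⟩ := exists_inflate_eq_cons q h2
  have hl : tilingLayer p q (ℓ + 1) = (i :: u) :: us := e
  have hmem : i :: u ∈ inflate q (patchBoundary p ℓ (tilingLayer p q ℓ)) := by rw [e]; simp
  obtain ⟨s, hs, rfl⟩ := exists_of_mem_inflate hmem List.mem_cons_self
  refine ⟨s.1, (mem_patchBoundary h1 hs).1, by rw [layerSize, hl]; simp, ?_⟩
  simp [hl]

theorem IsingBound.first_of_layer {x : ℝ} (hx : 0 ≤ x) (h : IsHyperbolic p q) {ℓ : ℕ}
    (hℓ : ℓ + 1 ≤ L) {m k : ℕ}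
    (hb : IsingBound x (patchGraph p q L) (firstTiles p q L (ℓ + 1) 0) m k) :
    IsingBound x (patchGraph p q L) (firstTiles p q L (ℓ + 1) 1) (m + 1) (k + 2) := by
  obtain ⟨i, hi, hj, hmem⟩ := exists_glued h ℓ
  refine hb.pendant hx ?_ ?_ (adj_patchTile_glued hℓ hi hj hmem) (firstTiles_mono (by lia)) ?_ <;>
    rw [patchTile_mem_firstTiles] <;> lia

theorem isingBound_layer_zero (x : ℝ) :
    IsingBound x (patchGraph p q L) (firstTiles p q L 1 0) 1 0 := by
  refine (IsingBound.single x _ (patchTile (p := p) (q := q) (ℓ := 0) (j := 0) (Nat.zero_le L)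
    (by rw [layerSize_zero]; lia))).mono ?_
  rintro s rfl
  rw [patchTile_mem_firstTiles]; lia

/-- Spanning-tree bound: each layer hangs from the previous one by its first tile and is then
traversed in order, so every tile costs two half powers. -/
theorem isingBound_firstTiles {x : ℝ} (hx : 0 ≤ x) (h : IsHyperbolic p q) {ℓ : ℕ} (hℓ : ℓ ≤ L) :
    IsingBound x (patchGraph p q L) (firstTiles p q L (ℓ + 1) 0) (1 + innerTiles p q ℓ)
      (2 * innerTiles p q ℓ) := by
  induction ℓ with
  | zero => exact isingBound_layer_zero x
  | succ ℓ ih =>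
    have h1 := (ih (by lia)).first_of_layer hx h hℓ
    obtain ⟨-, -, hpos, -⟩ := exists_glued h ℓ
    have h2 := (h1.pendants hx hℓ le_rfl (layerSize p q (ℓ + 1) - 1) (by lia)).mono
      (firstTiles_layerSize _ _)
    have e1 : 1 + innerTiles p q (ℓ + 1) =
        1 + innerTiles p q ℓ + 1 + (layerSize p q (ℓ + 1) - 1) := by
      rw [innerTiles, Finset.sum_range_succ, ← innerTiles]; lia
    have e2 : 2 * innerTiles p q (ℓ + 1) =
        2 * innerTiles p q ℓ + 2 + 2 * (layerSize p q (ℓ + 1) - 1) := by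
      rw [innerTiles, Finset.sum_range_succ, ← innerTiles]; lia
    rw [e1, e2]
    exact h2

/-- In the tiling `{p,5}`, the Ising bound improves along the segments of a layer that end in a
tile glued to the previous layer. -/
theorem IsingBound.segments {x : ℝ} (hx : 0 ≤ x) (hx2 : x ≤ 1 / 2) {ℓ : ℕ} (hℓ : ℓ + 1 ≤ L)
    {bs : List (ℕ × ℕ)} (hbs : ∀ s ∈ bs, s.1 < layerSize p q ℓ ∧ (s.2 = 1 ∨ s.2 = 2))
    {j g : ℕ} (hj : 1 ≤ j) (hg : g = 1 ∨ g = 2) (hjm : j ≤ layerSize p q (ℓ + 1))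
    (hdrop : (tilingLayer p q (ℓ + 1)).drop j = List.replicate g [] ++ inflate 5 bs) {m k : ℕ}
    (hb : IsingBound x (patchGraph p q L) (firstTiles p q L (ℓ + 1) j) m k) :
    ∃ K, K + bs.length = 2 * (layerSize p q (ℓ + 1) - j) ∧
      IsingBound x (patchGraph p q L) (firstTiles p q L (ℓ + 1) (layerSize p q (ℓ + 1)))
        (m + (layerSize p q (ℓ + 1) - j)) (k + K) := by
  induction bs generalizing j g m k with
  | nil =>
    have hlen := congrArg List.length hdrop
    rw [List.length_drop, ← layerSize] at hlen
    simp only [inflate, List.append_nil, List.length_replicate] at hlen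
    -- After the last glued tile no cycle can be closed towards the inner layer; the remaining
    -- corner tiles are pendant.
    refine ⟨2 * g, by simp [hlen], ?_⟩
    have := hb.pendants hx hℓ hj g (by lia)
    rw [hlen]
    rwa [show layerSize p q (ℓ + 1) = j + g by lia]
  | cons s bs ih =>
    obtain ⟨i, t⟩ := s
    have ht : i < layerSize p q ℓ ∧ (t = 1 ∨ t = 2) := hbs (i, t) List.mem_cons_self
    rw [inflate, if_pos (by lia)] at hdrop
    have hlen := congrArg List.length hdrop
    rw [List.length_drop, ← layerSize] at hlen
    simp only [List.length_append, List.length_cons, List.length_replicate] at hlen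
    have hlt : j + g < layerSize p q (ℓ + 1) := by lia
    have hget : i ∈ (tilingLayer p q (ℓ + 1))[j + g]'hlt := by
      have h1 : (tilingLayer p q (ℓ + 1))[j + g]? = some [i] := by
        rw [← List.getElem?_drop, hdrop, List.getElem?_append_right (by simp)]
        simp
      rw [List.getElem?_eq_getElem hlt] at h1
      rw [Option.some.inj h1]
      simp
    have hdrop' : (tilingLayer p q (ℓ + 1)).drop (j + g + 1) =
        List.replicate (5 - t - 2) [] ++ inflate 5 bs := by
      have h1 : (List.replicate g ([] : List ℕ) ++ [i] :: (List.replicate (5 - t - 2) [] ++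
          inflate 5 bs)).drop (g + 1) = List.replicate (5 - t - 2) [] ++ inflate 5 bs := by
        rw [List.drop_append]
        simp
      rw [← h1, ← hdrop, List.drop_drop]
      congr 1
    -- The g corner tiles and the next glued tile form a path from tile j - 1 to the inner layer: g
    -- + 1 new vertices for 2g + 1 half powers instead of 2g + 2.
    have hstep : IsingBound x (patchGraph p q L) (firstTiles p q L (ℓ + 1) (j + g + 1)) (m + (g + 1))
        (k + (2 * g + 1)) := by
      have hglue := (adj_patchTile_glued hℓ ht.1 hlt hget).symm
      have hmono : firstTiles p q L (ℓ + 1) j ⊆ firstTiles p q L (ℓ + 1) (j + g + 1) :=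
        firstTiles_mono (by lia)
      rcases hg with rfl | rfl
      · have a1 := adj_patchTile_succ (p := p) (q := q) (j := j - 1) hℓ (by lia)
        have a2 := adj_patchTile_succ (p := p) (q := q) (j := j) hℓ (by lia)
        simp only [Nat.sub_add_cancel hj] at a1
        refine hb.path₂ hx hx2 ?_ ?_ ?_ ?_ a1 a2 hglue hmono ?_ ?_ <;>
          rw [patchTile_mem_firstTiles] <;> lia
      · have a1 := adj_patchTile_succ (p := p) (q := q) (j := j - 1) hℓ (by lia)
        have a2 := adj_patchTile_succ (p := p) (q := q) (j := j) hℓ (by lia)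
        have a3 := adj_patchTile_succ (p := p) (q := q) (j := j + 1) hℓ (by lia)
        simp only [Nat.sub_add_cancel hj] at a1
        refine hb.path₃ hx hx2 ?_ ?_ ?_ ?_ ?_ ?_ a1 a2 a3 hglue hmono ?_ ?_ ?_
        case inr.refine_6 =>
          intro e
          have := Fin.mk.inj_iff.mp (eq_of_heq (Sigma.mk.inj_iff.mp e).2)
          lia
        all_goals rw [patchTile_mem_firstTiles]; lia
    obtain ⟨K, hK, hfin⟩ := ih (fun s hs => hbs s (List.mem_cons_of_mem _ hs)) (by lia)
      (g := 5 - t - 2) (by lia) (by lia) hdrop' hstep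
    refine ⟨2 * g + 1 + K, ?_, ?_⟩
    · rw [List.length_cons]; lia
    · convert hfin using 1 <;> lia

/-- Every side of an inner boundary saves a half power, except the one belonging to the first tile
of each layer, which is attached as a pendant. These exceptions add up to ℓ. -/
theorem isingBound_firstTiles_five {x : ℝ} (hx : 0 ≤ x) (hx2 : x ≤ 1 / 2) (h : IsHyperbolic p 5)
    {ℓ : ℕ} (hℓ : ℓ ≤ L) :
    ∃ k, k + ∑ i ∈ Finset.range ℓ, boundarySize p 5 i = 2 * innerTiles p 5 ℓ + ℓ ∧
      IsingBound x (patchGraph p 5 L) (firstTiles p 5 L (ℓ + 1) 0) (1 + innerTiles p 5 ℓ) k := by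
  induction ℓ with
  | zero => exact ⟨0, by simp [innerTiles], isingBound_layer_zero x⟩
  | succ ℓ ih =>
    obtain ⟨k, hk, hb⟩ := ih (by lia)
    have h1 := hb.first_of_layer hx h hℓ
    obtain ⟨hne, hne', -, -⟩ := tilingLayer_spec h ℓ
    have hmem := fun s => mem_patchBoundary (p := p) (ℓ := ℓ) (s := s) hne
    have hlayer : tilingLayer p 5 (ℓ + 1) = inflate 5 (patchBoundary p ℓ (tilingLayer p 5 ℓ)) := rfl
    have hsize : boundarySize p 5 ℓ = (patchBoundary p ℓ (tilingLayer p 5 ℓ)).length := rfl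
    cases hbs : patchBoundary p ℓ (tilingLayer p 5 ℓ) with
    | nil => exact absurd hbs hne'
    | cons s bs =>
      obtain ⟨i, t⟩ := s
      rw [hbs] at hmem hlayer hsize
      have ht : t = 1 ∨ t = 2 := (hmem (i, t) List.mem_cons_self).2
      rw [inflate, if_pos (by lia)] at hlayer
      have hpos : 1 ≤ layerSize p 5 (ℓ + 1) := by
        rw [layerSize, hlayer, List.length_cons]; lia
      obtain ⟨K, hK, hfin⟩ := h1.segments hx hx2 hℓ (bs := bs) (g := 5 - t - 2)
        (fun s hs => hmem s (List.mem_cons_of_mem _ hs)) le_rfl (by lia) hpos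
        (by rw [hlayer, List.drop_one, List.tail_cons])
      have hfin := hfin.mono (firstTiles_layerSize _ _)
      have e1 : innerTiles p 5 (ℓ + 1) = innerTiles p 5 ℓ + layerSize p 5 (ℓ + 1) := by
        rw [innerTiles, Finset.sum_range_succ, ← innerTiles]
      refine ⟨k + 2 + K, ?_, ?_⟩
      · rw [Finset.sum_range_succ, e1, hsize, List.length_cons]; lia
      · convert hfin using 1
        lia

theorem isingSum_patchGraph_le {x : ℝ} (hx : 0 ≤ x) (hx1 : x ≤ 1) {k : ℕ}
    (h : IsingBound x (patchGraph p q L) (firstTiles p q L (L + 1) 0) (1 + innerTiles p q L) k)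
    {S : Finset (Sym2 (PatchTile p q L))} (hS : ∀ e ∈ (patchGraph p q L).edgeSet, e ∈ S) :
    isingSum x S ^ 2 ≤ 4 * (1 + x) ^ k := by
  rw [← card_patchTile] at h
  exact h.isingSum_le hx hx1 hS

end PatchIsing

/-! ### Growth of the patches -/

section Growth

variable {p q : ℕ}

theorem isHyperbolic_of_lt (hp : 3 < p) (hq : 3 ≤ q) (h : (1 : ℝ) / p + 1 / q < 1 / 2) :
    IsHyperbolic p q := by
  have hp0 : (0 : ℝ) < p := by exact_mod_cast (by lia : 0 < p)
  have hq0 : (0 : ℝ) < q := by exact_mod_cast (by lia : 0 < q)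
  rw [div_add_div _ _ hp0.ne' hq0.ne', div_lt_div_iff₀ (by positivity) (by norm_num)] at h
  have h' : (1 * q + p * 1) * 2 < 1 * (p * q) := by exact_mod_cast h
  unfold IsHyperbolic
  rcases Nat.lt_or_ge q 4 with hq4 | hq4
  · obtain rfl : q = 3 := by lia
    right; lia
  · left
    refine ⟨hp, hq4, ?_⟩
    by_contra hlt
    obtain rfl : p = 4 := by lia
    obtain rfl : q = 4 := by lia
    lia

theorem two_mul_sum_boundarySize (h : IsHyperbolic p q) (L : ℕ) :
    2 * ∑ i ∈ Finset.range L, boundarySize p q i + boundarySize p q L =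
      (p - 2) * innerTiles p q L + p := by
  induction L with
  | zero => simp [innerTiles, boundarySize_zero]
  | succ L ih =>
    rw [Finset.sum_range_succ, innerTiles, Finset.sum_range_succ, ← innerTiles, mul_add]
    have := boundarySize_add h L
    lia

theorem boundarySize_le (h : IsHyperbolic p q) (L : ℕ) :
    boundarySize p q (L + 1) ≤ (p - 2) * layerSize p q (L + 1) := by
  have := boundarySize_add h L
  lia

/-- Inserting n ≤ Pm into `innerTiles_eq` gives S ≤ n(PQ - 2)/(P(PQ - 4)); `hineq` says that this
ratio is at most 17/24. -/
theorem innerTiles_le_of_sparse (P Q : ℕ) (h : IsHyperbolic (P + 2) (Q + 2)) (hP : 2 ≤ P)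
    (hPQ : 5 ≤ P * Q) (hineq : 24 * (P * Q) + 17 * (4 * P) ≤ 17 * (P * (P * Q)) + 48) (L : ℕ) :
    24 * innerTiles (P + 2) (Q + 2) (L + 1) ≤ 17 * boundarySize (P + 2) (Q + 2) (L + 1) := by
  have h1 := innerTiles_eq P Q h L
  have h2 := boundarySize_le h L
  rw [Nat.add_sub_cancel] at h2
  generalize innerTiles (P + 2) (Q + 2) (L + 1) = S at *
  generalize boundarySize (P + 2) (Q + 2) (L + 1) = n at *
  generalize layerSize (P + 2) (Q + 2) (L + 1) = m at *
  zify at *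
  have hpos : (0 : ℤ) < P * (P * Q - 4) := by
    apply mul_pos <;> linarith
  refine le_of_mul_le_mul_left ?_ hpos
  have e1 : (P * (P * Q - 4) * (24 * S) : ℤ) = 24 * (P * Q * n - 2 * (P * m) - P * Q * (P + 2)) := by
    linear_combination (24 * P : ℤ) * h1
  have e2 : (0 : ℤ) ≤ P * Q * (P + 2) := by positivity
  have e3 : (24 * (P * Q) - 48 : ℤ) * n ≤ (17 * (P * (P * Q)) - 17 * (4 * P)) * n :=
    mul_le_mul_of_nonneg_right (by linarith) (by positivity)
  rw [e1]
  linarith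

/-- The estimate n ≤ Pm would give only 3/4 here. The limiting ratio is √2/2 ≈ 0.7071, just below
17/24 ≈ 0.7083, so the recursions are followed one layer further back. -/
theorem four_six_bounds (L : ℕ) :
    24 * innerTiles 4 6 (L + 2) ≤ 17 * boundarySize 4 6 (L + 2) := by
  have h : IsHyperbolic 4 6 := by unfold IsHyperbolic; lia
  have h1 := innerTiles_eq 2 4 h (L + 1)
  have h2 := boundarySize_add h L
  have h3 := boundarySize_add h (L + 1)
  have h4 := layerSize_add h L
  lia

/-- The linear growth absorbs the term ℓ of `isingBound_firstTiles_five`. The comparison of layer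
and boundary drives the induction, since the next boundary has size 5n - 2m. -/
theorem four_five_bounds (L : ℕ) :
    60 * (L + 1) ≤ boundarySize 4 5 (L + 2) ∧
      layerSize 4 5 (L + 2) ≤ boundarySize 4 5 (L + 2) := by
  have h : IsHyperbolic 4 5 := by unfold IsHyperbolic; lia
  induction L with
  | zero =>
    have h0 := boundarySize_zero (p := 4) (q := 5)
    have h1 := boundarySize_add h 0
    have h2 := boundarySize_add h 1
    have h3 := layerSize_one h
    have h4 := layerSize_add h 0
    norm_num at *
    lia
  | succ L ih =>
    have h2 := boundarySize_add h (L + 2)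
    have h4 := layerSize_add h (L + 1)
    norm_num [add_assoc] at *
    lia

/-- As k counts half powers, the inequality bounds the exponent of 1 + x by (17/24)n. -/
theorem exists_isingBound_patch {x : ℝ} (hx : 0 ≤ x) (hx2 : x ≤ 1 / 2) (h : IsHyperbolic p q)
    (L : ℕ) : ∃ k, 12 * k ≤ 17 * boundarySize p q (L + 2) ∧
      IsingBound x (patchGraph p q (L + 2)) (firstTiles p q (L + 2) (L + 3) 0)
        (1 + innerTiles p q (L + 2)) k := by
  by_cases h45 : p = 4 ∧ q = 5
  · obtain ⟨rfl, rfl⟩ := h45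
    obtain ⟨k, hk, hb⟩ := isingBound_firstTiles_five (L := L + 2) hx hx2 h le_rfl
    refine ⟨k, ?_, hb⟩
    have h1 := two_mul_sum_boundarySize h (L + 2)
    have h2 := innerTiles_eq 2 3 h (L + 1)
    have h3 := boundarySize_add h L
    have h4 := boundarySize_add h (L + 1)
    have h5 := layerSize_add h L
    have h6 := (four_five_bounds L).1
    lia
  refine ⟨2 * innerTiles p q (L + 2), ?_, isingBound_firstTiles hx h le_rfl⟩
  rw [← mul_assoc]
  by_cases h46 : p = 4 ∧ q = 6
  · obtain ⟨rfl, rfl⟩ := h46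
    exact four_six_bounds L
  have h' := h
  unfold IsHyperbolic at h'
  obtain ⟨P, rfl⟩ : ∃ P, p = P + 2 := ⟨p - 2, by lia⟩
  obtain ⟨Q, rfl⟩ : ∃ Q, q = Q + 2 := ⟨q - 2, by lia⟩
  rcases Nat.lt_or_ge P 5 with hP | hP
  · interval_cases P
    · lia
    · lia
    all_goals exact innerTiles_le_of_sparse _ Q h (by lia) (by lia) (by lia) (L + 1)
  · have hQ : 1 ≤ Q := by lia
    have hPQ : 5 ≤ P * Q := by nlinarith
    exact innerTiles_le_of_sparse P Q h (by lia) hPQ (by nlinarith) (L + 1)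

end Growth

/-! ### The comparison -/

section Comparison

/-- For x ≤ 1/3 already (1 + x²/2)⁴ ≤ 1 + x, which leaves a factor to spare. At x = 1/2 the two
sides are about 16.9 and 17.1, so 17/24 is close to the largest admissible ratio. -/
theorem one_add_pow_lt {x : ℝ} (hx : 0 < x) (hx2 : x ≤ 1 / 3 ∨ x = 1 / 2) :
    (1 + x ^ 2 / 2) ^ 24 < (1 + x) ^ 7 := by
  rcases hx2 with h | rfl
  · have e2 : x ^ 2 ≤ x * (1 / 3) := by nlinarith
    have e0 : ∀ j : ℕ, x ^ (j + 1) ≤ x * (1 / 3) ^ j := fun j => by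
      have := pow_le_pow_left₀ hx.le h j
      calc x ^ (j + 1) = x * x ^ j := by ring
        _ ≤ _ := by gcongr
    have e4 := e0 3
    have e6 := e0 5
    have e8 := e0 7
    have h4 : (1 + x ^ 2 / 2) ^ 4 ≤ 1 + x := by
      have : (1 + x ^ 2 / 2) ^ 4 = 1 + 2 * x ^ 2 + 3 / 2 * x ^ 4 + 1 / 2 * x ^ 6 + x ^ 8 / 16 := by
        ring
      rw [this]
      norm_num at *
      linarith
    calc (1 + x ^ 2 / 2) ^ 24 = ((1 + x ^ 2 / 2) ^ 4) ^ 6 := by ring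
      _ ≤ (1 + x) ^ 6 := pow_le_pow_left₀ (by positivity) h4 6
      _ < (1 + x) ^ 7 := pow_lt_pow_right₀ (by linarith) (by norm_num)
  · norm_num

theorem invEffDim_le {V : Type*} [Fintype V] {G : SimpleGraph V} {ext : V → ℕ} {a b d : ℕ}
    (R : RTN G ext a b d) (ha : a ≠ 0) (hb : b ≠ 0) (hd : d ≠ 0) (hR : R.Unentangled) :
    ∃ S : Finset (Sym2 V), (∀ e ∈ G.edgeSet, e ∈ S) ∧
      R.invEffDim ≤ ((a : ℝ) ^ Fintype.card (PhysSite ext))⁻¹ * isingSum (1 / b) S := by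
  classical
  refine ⟨G.edgeFinset, fun e he => by simpa using he, ?_⟩
  rw [R.invEffDim_eq ha hb hd hR, mul_assoc]
  refine mul_le_mul_of_nonneg_left ?_ (by positivity)
  refine mul_le_of_le_one_left (isingSum_nonneg (by positivity) _)
    (Finset.prod_le_one (fun v _ => by positivity) fun v _ => ?_)
  rw [div_le_one (by positivity)]
  linarith

theorem exists_pow_bound {b : ℕ} (hb : 2 ≤ b) : ∃ N : ℕ, ∀ n, N ≤ n → ∀ (z : ℝ) (k : ℕ),
    z ^ 2 ≤ 4 * (1 + 1 / (b : ℝ)) ^ k → 12 * k ≤ 17 * n → 0 < n →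
      z < (1 / 4 : ℝ) * (2 * (b : ℝ) ^ 2 / (2 * (b : ℝ) ^ 2 + 1)) ^ n *
        (2 * (1 / b) * (1 + 1 / b) ^ (n - 1)) := by
  have hb0 : (0 : ℝ) < b := by exact_mod_cast (by lia : 0 < b)
  set x : ℝ := 1 / (b : ℝ) with hx
  have hx0 : 0 < x := by positivity
  set ρ : ℝ := 2 * (b : ℝ) ^ 2 / (2 * (b : ℝ) ^ 2 + 1) with hρ
  have hρ0 : 0 < ρ := by positivity
  have hρx : ρ * (1 + x ^ 2 / 2) = 1 := by
    rw [hρ, hx]; field_simp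
  have hlt : (1 + x ^ 2 / 2) ^ 24 < (1 + x) ^ 7 := by
    refine one_add_pow_lt hx0 ?_
    rcases Nat.lt_or_ge b 3 with h | h
    · right
      rw [hx, show b = 2 by lia]; norm_num
    · left
      have : (3 : ℝ) ≤ b := by exact_mod_cast h
      exact one_div_le_one_div_of_le (by norm_num) this
  -- The growth rate of the gap; 24th powers clear the denominator of 17/24. Below, `K` collects the
  -- constants of the tensor-train bound.
  have hθ : 1 < ρ ^ 24 * (1 + x) ^ 7 := by
    calc (1 : ℝ) = ρ ^ 24 * (1 + x ^ 2 / 2) ^ 24 := by rw [← mul_pow, hρx, one_pow]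
      _ < _ := mul_lt_mul_of_pos_left hlt (by positivity)
  set K : ℝ := x / (2 * (1 + x)) with hK
  have hK0 : 0 < K := by positivity
  obtain ⟨N, hN⟩ := Filter.eventually_atTop.mp
    ((tendsto_pow_atTop_atTop_of_one_lt hθ).eventually_gt_atTop (4 ^ 12 / K ^ 24))
  refine ⟨N, fun n hn z k hzk hk hn0 => ?_⟩
  have hrhs : (1 / 4 : ℝ) * ρ ^ n * (2 * x * (1 + x) ^ (n - 1)) = K * (ρ * (1 + x)) ^ n := by
    obtain ⟨n, rfl⟩ : ∃ n', n = n' + 1 := ⟨n - 1, by lia⟩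
    rw [hK, Nat.add_sub_cancel, mul_pow, pow_succ (1 + x)]
    field_simp
    ring
  rw [hrhs]
  refine lt_of_pow_lt_pow_left₀ 24 (by positivity) ?_
  calc z ^ 24 = (z ^ 2) ^ 12 := by ring
    _ ≤ (4 * (1 + x) ^ k) ^ 12 := pow_le_pow_left₀ (by positivity) hzk 12
    _ = 4 ^ 12 * (1 + x) ^ (12 * k) := by rw [mul_pow, ← pow_mul, mul_comm k]
    _ ≤ 4 ^ 12 * (1 + x) ^ (17 * n) := by
        refine mul_le_mul_of_nonneg_left (pow_le_pow_right₀ (by linarith) hk) (by positivity)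
    _ < K ^ 24 * (ρ ^ 24 * (1 + x) ^ 7) ^ n * (1 + x) ^ (17 * n) := by
        refine mul_lt_mul_of_pos_right ?_ (by positivity)
        rw [mul_comm, ← div_lt_iff₀ (by positivity)]
        exact hN n hn
    _ = (K * (ρ * (1 + x)) ^ n) ^ 24 := by
        simp only [mul_pow, ← pow_mul]
        rw [show (1 + x) ^ (n * 24) = (1 + x) ^ (7 * n) * (1 + x) ^ (17 * n) by
          rw [← pow_add]; congr 1; ring, mul_comm 24 n]
        ring

end Comparison

theorem mainTheorem4 (p q : ℕ) (hp : 3 < p) (hq : 3 ≤ q)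
    (hyperbolic : (1 : ℝ) / p + 1 / q < 1 / 2) (b : ℕ) (hb : 2 ≤ b) :
    ∃ N : ℕ, ∀ L a d d' : ℕ, N ≤ patchSites p q L → 2 ≤ a → 1 ≤ d → 1 ≤ d' →
      ∀ R : RTN (patchGraph p q L) (patchExt p q L) a b d, R.Unentangled →
        (∀ T : OpenRTT (patchSites p q L) a b d', T.Unentangled → R.invEffDim < T.invEffDim) ∧
        (∀ T : ClosedRTT (patchSites p q L) a b d', T.Unentangled → R.invEffDim < T.invEffDim) := by
  have h := isHyperbolic_of_lt hp hq hyperbolic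
  obtain ⟨N, hN⟩ := exists_pow_bound hb
  -- The added boundary sizes exclude the patches with L = 0 and L = 1.
  refine ⟨N + boundarySize p q 0 + boundarySize p q 1 + 1, ?_⟩
  intro L a d d' hL ha hd hd' R hR
  have hn : patchSites p q L = boundarySize p q L := patchSites_eq h L
  obtain ⟨L, rfl⟩ : ∃ L', L = L' + 2 := by
    rcases L with _ | _ | L
    · lia
    · rw [zero_add] at hn; lia
    · exact ⟨L, rfl⟩
  have hb2 : (2 : ℝ) ≤ b := by exact_mod_cast hb
  have hx0 : (0 : ℝ) ≤ 1 / b := by positivity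
  have hx2 : 1 / (b : ℝ) ≤ 1 / 2 := one_div_le_one_div_of_le (by norm_num) hb2
  obtain ⟨S, hS, hRle⟩ := invEffDim_le R (by lia) (by lia) (by lia) hR
  obtain ⟨k, hk, hbound⟩ := exists_isingBound_patch hx0 hx2 h L
  have hpos : 0 < patchSites p q (L + 2) := by lia
  have hlt := hN _ (by lia) _ k (isingSum_patchGraph_le hx0 (by linarith) hbound hS) (hn.symm ▸ hk) hpos
  have hRlt : R.invEffDim < ((a : ℝ) ^ patchSites p q (L + 2))⁻¹ *
      ((1 / 4 : ℝ) * (2 * (b : ℝ) ^ 2 / (2 * (b : ℝ) ^ 2 + 1)) ^ patchSites p q (L + 2)) *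
        (2 * (1 / b) * (1 + 1 / b) ^ (patchSites p q (L + 2) - 1)) := by
    refine hRle.trans_lt ?_
    rw [mul_assoc]
    have ha0 : (0 : ℝ) < a := by exact_mod_cast (by lia : 0 < a)
    exact mul_lt_mul_of_pos_left hlt (by positivity)
  -- The open chain has no extra edge, so a degenerate loop fills the slot of the closing edge.
  exact ⟨fun T hT => hRlt.trans_le (le_invEffDim_tensorTrain hpos ha (by lia) hd' _ le_rfl
      s(⟨0, hpos⟩, ⟨0, hpos⟩) (fun e he => Or.inl he) T hT),
    fun T hT => hRlt.trans_le (le_invEffDim_tensorTrain hpos ha (by lia) hd' _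
      SimpleGraph.pathGraph_le_cycleGraph _ (fun e he => cycleGraph_edgeSet hpos e he) T hT)⟩
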